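/- Let $V$ be the swap on $\mathbb C^3\otimes\mathbb C^3$, $P_-=(I-V)/2$, $\rho_W(w)=w\,P_- /3+(1-w)\,I/9$ the qutrit Werner state, and $$\rho=\tfrac12|00\rangle\langle00|+\tfrac12\,\rho_W(\tfrac12).$$ Let $|v_j\rangle=\cos\theta|0\rangle+\sin\theta\cos\frac{4\pi j}5|1\rangle+\sin\theta\sin\frac{4\pi j}5|2\rangle$ ($j\in\mathbb Z/5$) with $\cos\theta,\sin\theta>0$ and $\cos^2\theta=1/\sqrt5$, $P_j=|v_j\rangle\langle v_j|$ (so $P_jP_{j+1}=0$), $B_j=I-2P_j$, $D=\sum_jB_jB_{j+1}$. The KCBS scenario has the five binary measurements $\{I-P_j,P_j\}$ and the five contexts $\{j,j+1\}$; the flag scenario has the single measurement $\{I-|0\rangle\langle0|,|0\rangle\langle0|\}$ as its only context. For one party, given a family of local contexts (finite sets of measurements performed jointly), the statistics $p_C$ are *locally noncontextual* if there are one probability space $(\Lambda,\mu)$ and measurable response functions $p(m|j,\lambda)$ (probability distributions in the outcome $m$) for the single measurements $j$ with $p_C((m_j)_{j\in C})=\int\prod_{j\in C}p(m_j|j,\lambda)\,d\mu$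 for every context $C$. For two parties and a tested family of pairs $(C,D)$ of local contexts, a *GLHV model* is one probability space with measurable block responses such that $p_{C,D}(\mathbf a,\mathbf b)=\int p_A(\mathbf a|C,\lambda)\,p_B(\mathbf b|D,\lambda)\,d\mu$ for all tested pairs; a *GNCHV model* is one probability space with responses of single measurements such that $p_{C,D}(\mathbf a,\mathbf b)=\int\prod_{j\in C}p(a_j|j,\lambda)\prod_{k\in D}p(b_k|k,\lambda)\,d\mu$ for all tested pairs. Then $\rho$ is a density operator with the following properties. 1. $\rho$ is local for all projective measurements: one probability space and measurable response functions for all finite-outcome projective measurements of Alice and of Bob reproduce $\operatorname{Tr}(\rho\,P_a\otimes Q_b)=\int p_A(a|P,\lambda)\,p_B(b|Q,\lambda)\,d\mu$ for all $P,Q,a,b$. Consequently, for all choices of local families of projective measurements whose contexts are finite sets of commuting measurements, and every tested family of pairs of contexts, the statistics of $\rho$ have a GLHV model. 2. $\rho$ is NPT: the smallest eigenvalue of its partial transpose is $(37-3\sqrt{177})/144<0$. In particular $\rho$ is not separable. 3. The marginals are $\rho_A=\rho_B=\operatorname{diag}(\frac23,\frac16,\frac16)$. For $\sigma=\rho_A,\rho_B$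 one has $\operatorname{Tr}(\sigma D)=\frac53-2\sqrt5$ and $\sum_j\gamma_j\operatorname{Tr}(\sigma B_jB_{j+1})\ge-3$ for all signs $\gamma_j=\pm1$ with $\prod_j\gamma_j=1$, and the KCBS statistics of $\sigma$ are locally noncontextual. The flag statistics of $\rho_A$ are locally noncontextual as well. 4. Alice's flag outcome $|0\rangle\langle0|$ has probability $\frac23$, Bob's state conditional on it is $\rho_{B|0}=\operatorname{diag}(\frac{19}{24},\frac5{48},\frac5{48})$, and $\operatorname{Tr}(\rho_{B|0}D)=(35-33\sqrt5)/12<-3$. 5. The joint statistics of $\rho$ for Alice's flag scenario and Bob's KCBS scenario, with all pairs of contexts tested, have no GNCHV model. -/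

import Mathlib

open scoped Matrix Kronecker BigOperators ComplexOrder
open MeasureTheory

/-! ## Measurement scenarios and hidden-variable models -/

/-- The measurement scenario of one party: a set of measurements, the number of outcomes of each,
and the family of local contexts (finite sets of measurements that can be performed together). -/
structure Scenario where
  Meas : Type
  nOut : Meas → ℕ
  ctx : Set (Finset Meas)

/-- A joint outcome of all the measurements in a set `C` of measurements. -/
abbrev Scenario.Block (S : Scenario) (C : Finset S.Meas) : Type :=
  (j : C) → Fin (S.nOut j)

/-- The outcome statistics of one party: a table for each local context. -/
abbrev Scenario.LocalTable (S : Scenario) : Type :=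
  (C : S.ctx) → S.Block C → ℝ

/-- The outcome statistics of two parties: a table for each pair of local contexts. -/
abbrev JointTable (SA SB : Scenario) : Type :=
  (C : SA.ctx) → (D : SB.ctx) → SA.Block C → SB.Block D → ℝ

/-- A response function: for each value `l` of the hidden variable a probability distribution
on the outcomes, depending measurably on `l`. -/
def IsResponse {Λ O : Type} [MeasurableSpace Λ] [Fintype O] (r : Λ → O → ℝ) : Prop :=
  (∀ o, Measurable fun l => r l o) ∧ (∀ l o, 0 ≤ r l o) ∧ ∀ l, ∑ o, r l o = 1

/-- Local noncontextuality of one party: one hidden-variable distribution, and response functions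
assigned to single measurements, reproduce the statistics of every local context. -/
def IsNCHVLocal (S : Scenario) (p : S.LocalTable) : Prop :=
  ∃ (Λ : Type) (_ : MeasurableSpace Λ) (μ : Measure Λ) (r : (j : S.Meas) → Λ → Fin (S.nOut j) → ℝ),
    IsProbabilityMeasure μ ∧ (∀ j, IsResponse (r j)) ∧
    ∀ (C : S.ctx) (m : S.Block C), p C m = ∫ l, ∏ j : C.1, r j l (m j) ∂μ

open Classical in
/-- Generalized local hidden-variable model on a tested family of pairs of local contexts: one
hidden-variable distribution, and for each party a block response function for every local
context, which need not factor over the measurements in the context. -/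
def HasGLHV (SA SB : Scenario) (tested : Set (SA.ctx × SB.ctx)) (p : JointTable SA SB) : Prop :=
  ∃ (Λ : Type) (_ : MeasurableSpace Λ) (μ : Measure Λ)
    (rA : (C : SA.ctx) → Λ → SA.Block C → ℝ) (rB : (D : SB.ctx) → Λ → SB.Block D → ℝ),
    IsProbabilityMeasure μ ∧ (∀ C, IsResponse (rA C)) ∧ (∀ D, IsResponse (rB D)) ∧
    ∀ CD ∈ tested, ∀ (a : SA.Block CD.1) (b : SB.Block CD.2),
      p CD.1 CD.2 a b = ∫ l, rA CD.1 l a * rB CD.2 l b ∂μ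

/-- Global noncontextual hidden-variable model on a tested family: one hidden-variable
distribution, and context-independent response functions of all single measurements. -/
def HasGNCHV (SA SB : Scenario) (tested : Set (SA.ctx × SB.ctx)) (p : JointTable SA SB) : Prop :=
  ∃ (Λ : Type) (_ : MeasurableSpace Λ) (μ : Measure Λ)
    (rA : (j : SA.Meas) → Λ → Fin (SA.nOut j) → ℝ) (rB : (k : SB.Meas) → Λ → Fin (SB.nOut k) → ℝ),
    IsProbabilityMeasure μ ∧ (∀ j, IsResponse (rA j)) ∧ (∀ k, IsResponse (rB k)) ∧
    ∀ CD ∈ tested, ∀ (a : SA.Block CD.1) (b : SB.Block CD.2),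
      p CD.1 CD.2 a b =
        ∫ l, (∏ j : CD.1.1, rA j l (a j)) * ∏ k : CD.2.1, rB k l (b k) ∂μ

/-! ## Projective measurements -/

/-- A projective measurement with `k` outcomes on `ℂ^d`: orthogonal projections summing to the
identity (some of them may vanish; they are then automatically mutually orthogonal). -/
structure PVM (d k : ℕ) where
  proj : Fin k → Matrix (Fin d) (Fin d) ℂ
  isProj : ∀ a, IsStarProjection (proj a)
  sum_eq_one : ∑ a, proj a = 1

/-- A scenario of projective measurements on `ℂ^d` whose contexts are compatible: the
projections of any two measurements in the same context commute. -/
structure ProjScenario (d : ℕ) extends Scenario where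
  pvm : (j : Meas) → PVM d (nOut j)
  compatible : ∀ C ∈ ctx, ∀ i ∈ C, ∀ j ∈ C, ∀ a b, Commute ((pvm i).proj a) ((pvm j).proj b)

/-- The projection onto a joint outcome of a compatible context: the product of the commuting
projections of the individual outcomes. -/
noncomputable def ProjScenario.blockProj {d : ℕ} (S : ProjScenario d) (C : S.ctx)
    (m : S.Block C) : Matrix (Fin d) (Fin d) ℂ :=
  (Finset.univ : Finset C.1).noncommProd (fun j => (S.pvm j).proj (m j))
    fun i _ j _ _ => S.compatible C.1 C.2 i i.2 j j.2 (m i) (m j)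

/-- The Born statistics of a one-party state. -/
noncomputable def ProjScenario.localTable {d : ℕ} (S : ProjScenario d)
    (σ : Matrix (Fin d) (Fin d) ℂ) : S.toScenario.LocalTable :=
  fun C m => (σ * S.blockProj C m).trace.re

/-- The Born statistics of a two-party state. -/
noncomputable def jointTable {d e : ℕ} (SA : ProjScenario d) (SB : ProjScenario e)
    (ρ : Matrix (Fin d × Fin e) (Fin d × Fin e) ℂ) : JointTable SA.toScenario SB.toScenario :=
  fun C D a b => (ρ * (SA.blockProj C a ⊗ₖ SB.blockProj D b)).trace.re

/-- Locality for all projective measurements: one hidden-variable distribution and response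
functions for all projective measurements of each party reproduce all the Born statistics. -/
def IsProjectiveLocal {d e : ℕ} (ρ : Matrix (Fin d × Fin e) (Fin d × Fin e) ℂ) : Prop :=
  ∃ (Λ : Type) (_ : MeasurableSpace Λ) (μ : Measure Λ)
    (rA : (k : ℕ) → PVM d k → Λ → Fin k → ℝ) (rB : (k : ℕ) → PVM e k → Λ → Fin k → ℝ),
    IsProbabilityMeasure μ ∧ (∀ k P, IsResponse (rA k P)) ∧ (∀ k Q, IsResponse (rB k Q)) ∧
    ∀ (k l : ℕ) (P : PVM d k) (Q : PVM e l) (a : Fin k) (b : Fin l),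
      (ρ * (P.proj a ⊗ₖ Q.proj b)).trace.re = ∫ x, rA k P x a * rB l Q x b ∂μ

/-- The two-outcome measurement of an orthogonal projection `P`: outcome `1` is `P`, outcome `0`
is `1 - P`. -/
def binaryPVM {d : ℕ} (P : Matrix (Fin d) (Fin d) ℂ) (hP : IsStarProjection P) : PVM d 2 where
  proj := ![1 - P, P]
  isProj := by
    intro a
    fin_cases a
    · exact hP.one_sub
    · exact hP
  sum_eq_one := by simp [Fin.sum_univ_two]

/-! ## States -/

/-- Density matrices. -/
def IsState {n : Type} [Fintype n] (ρ : Matrix n n ℂ) : Prop :=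
  ρ.PosSemidef ∧ ρ.trace = 1

/-- Separable two-party states: finite convex combinations of product states. -/
def IsSeparableState {d e : ℕ} (ρ : Matrix (Fin d × Fin e) (Fin d × Fin e) ℂ) : Prop :=
  ∃ (n : ℕ) (q : Fin n → ℝ) (σ : Fin n → Matrix (Fin d) (Fin d) ℂ)
    (τ : Fin n → Matrix (Fin e) (Fin e) ℂ),
    (∀ i, 0 ≤ q i) ∧ ∑ i, q i = 1 ∧ (∀ i, IsState (σ i)) ∧ (∀ i, IsState (τ i)) ∧
    ρ = ∑ i, (q i : ℂ) • (σ i ⊗ₖ τ i)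

/-- Partial transpose on the second factor. -/
def partialTranspose {d e : ℕ} (ρ : Matrix (Fin d × Fin e) (Fin d × Fin e) ℂ) :
    Matrix (Fin d × Fin e) (Fin d × Fin e) ℂ :=
  Matrix.of fun x y => ρ (x.1, y.2) (y.1, x.2)

/-- The reduced matrix of the first party (the second party is traced out). -/
def marginalA {d e : ℕ} (ρ : Matrix (Fin d × Fin e) (Fin d × Fin e) ℂ) :
    Matrix (Fin d) (Fin d) ℂ :=
  Matrix.of fun i j => ∑ k, ρ (i, k) (j, k)

/-- The reduced matrix of the second party (the first party is traced out). -/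
def marginalB {d e : ℕ} (ρ : Matrix (Fin d × Fin e) (Fin d × Fin e) ℂ) :
    Matrix (Fin e) (Fin e) ℂ :=
  Matrix.of fun i j => ∑ k, ρ (k, i) (k, j)

/-- Probability that the first party obtains the outcome with projection `P`. -/
noncomputable def probA {d e : ℕ} (ρ : Matrix (Fin d × Fin e) (Fin d × Fin e) ℂ)
    (P : Matrix (Fin d) (Fin d) ℂ) : ℝ :=
  (ρ * (P ⊗ₖ (1 : Matrix (Fin e) (Fin e) ℂ))).trace.re

/-- State of the second party after the first party obtained the outcome with projection `P`. -/
noncomputable def conditionalB {d e : ℕ} (ρ : Matrix (Fin d × Fin e) (Fin d × Fin e) ℂ)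
    (P : Matrix (Fin d) (Fin d) ℂ) : Matrix (Fin e) (Fin e) ℂ :=
  ((probA ρ P : ℂ))⁻¹ •
    marginalB ((P ⊗ₖ (1 : Matrix (Fin e) (Fin e) ℂ)) * ρ * (P ⊗ₖ (1 : Matrix (Fin e) (Fin e) ℂ)))

/-- The swap operator on `ℂ³ ⊗ ℂ³`. -/
def swapOp : Matrix (Fin 3 × Fin 3) (Fin 3 × Fin 3) ℂ :=
  Matrix.of fun x y => if x.1 = y.2 ∧ x.2 = y.1 then 1 else 0

/-- The projection onto the antisymmetric subspace of `ℂ³ ⊗ ℂ³`. -/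
noncomputable def antisymProj : Matrix (Fin 3 × Fin 3) (Fin 3 × Fin 3) ℂ :=
  (1 / 2 : ℂ) • (1 - swapOp)

/-- The qutrit Werner state `w P₋ / 3 + (1 - w) I / 9`. -/
noncomputable def qutritWerner (w : ℝ) : Matrix (Fin 3 × Fin 3) (Fin 3 × Fin 3) ℂ :=
  ((w : ℂ) / 3) • antisymProj + ((1 - (w : ℂ)) / 9) • 1

/-- The flagged Werner state `ε |00⟩⟨00| + (1 - ε) ρ_W(w)`. -/
noncomputable def flaggedWerner (ε w : ℝ) : Matrix (Fin 3 × Fin 3) (Fin 3 × Fin 3) ℂ :=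
  (ε : ℂ) • Matrix.single (0, 0) (0, 0) 1 + (1 - (ε : ℂ)) • qutritWerner w

/-! ## The flag measurement and the KCBS measurements -/

/-- The flag projection `|0⟩⟨0|`. -/
def flagProj : Matrix (Fin 3) (Fin 3) ℂ := Matrix.single 0 0 1

lemma flagProj_isStarProjection : IsStarProjection flagProj where
  isIdempotentElem := by simp [IsIdempotentElem, flagProj]
  isSelfAdjoint := by
    rw [IsSelfAdjoint, Matrix.star_eq_conjTranspose, flagProj, Matrix.conjTranspose_single]
    simp

/-- The KCBS vectors, with `cos² θ = 1/√5`. -/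
noncomputable def kcbsVec (j : Fin 5) : Fin 3 → ℝ :=
  ![√(1 / √5),
    √((√5 - 1) / √5) * Real.cos (4 * Real.pi * (j : ℕ) / 5),
    √((√5 - 1) / √5) * Real.sin (4 * Real.pi * (j : ℕ) / 5)]

/-- The KCBS projections `P_j = |v_j⟩⟨v_j|`. -/
noncomputable def kcbsProj (j : Fin 5) : Matrix (Fin 3) (Fin 3) ℂ :=
  Matrix.of fun a b => ((kcbsVec j a * kcbsVec j b : ℝ) : ℂ)

/-- The `±1`-valued KCBS observables `B_j = I - 2 P_j`. -/
noncomputable def kcbsObs (j : Fin 5) : Matrix (Fin 3) (Fin 3) ℂ := 1 - (2 : ℂ) • kcbsProj j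

/-- The KCBS operator `D = ∑ B_j B_{j+1}`, indices modulo 5. -/
noncomputable def kcbsOp : Matrix (Fin 3) (Fin 3) ℂ := ∑ j, kcbsObs j * kcbsObs (j + 1)

/-- Expectation value `Tr (σ M)`. -/
noncomputable def expect {d : ℕ} (σ M : Matrix (Fin d) (Fin d) ℂ) : ℝ := (σ * M).trace.re

/-- All the five-cycle noncontextuality inequalities `∑ γ_j ⟨B_j B_{j+1}⟩ ≥ -3` with signs
`γ_j = ±1` of product `+1`. -/
def SatisfiesFiveCycle (σ : Matrix (Fin 3) (Fin 3) ℂ) : Prop :=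
  ∀ γ : Fin 5 → ℝ, (∀ j, γ j = 1 ∨ γ j = -1) → ∏ j, γ j = 1 →
    -3 ≤ ∑ j, γ j * expect σ (kcbsObs j * kcbsObs (j + 1))

lemma kcbsVec_dot (i j : Fin 5) : kcbsVec i ⬝ᵥ kcbsVec j =
    1 / √5 + (√5 - 1) / √5 *
      Real.cos (4 * Real.pi * (i : ℕ) / 5 - 4 * Real.pi * (j : ℕ) / 5) := by
  have h5 : (1 : ℝ) ≤ √5 := by rw [Real.one_le_sqrt]; norm_num
  have h1 : √(1 / √5) * √(1 / √5) = 1 / √5 := Real.mul_self_sqrt (by positivity)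
  have h2 : √((√5 - 1) / √5) * √((√5 - 1) / √5) = (√5 - 1) / √5 :=
    Real.mul_self_sqrt (div_nonneg (by linarith) (by linarith))
  rw [Real.cos_sub]
  simp only [kcbsVec, dotProduct, Fin.sum_univ_three, Matrix.cons_val]
  linear_combination h1 + (Real.cos (4 * Real.pi * (i : ℕ) / 5) *
    Real.cos (4 * Real.pi * (j : ℕ) / 5) + Real.sin (4 * Real.pi * (i : ℕ) / 5) *
    Real.sin (4 * Real.pi * (j : ℕ) / 5)) * h2

lemma kcbsVec_dot_self (j : Fin 5) : kcbsVec j ⬝ᵥ kcbsVec j = 1 := by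
  have h5 : √5 ≠ (0 : ℝ) := by positivity
  rw [kcbsVec_dot, sub_self, Real.cos_zero]
  field_simp
  ring

lemma cos_four_pi_div_five : Real.cos (4 * Real.pi / 5) = -(1 + √5) / 4 := by
  rw [show 4 * Real.pi / 5 = Real.pi - Real.pi / 5 by ring, Real.cos_pi_sub,
    Real.cos_pi_div_five]
  ring

lemma kcbsVec_dot_succ (j : Fin 5) : kcbsVec j ⬝ᵥ kcbsVec (j + 1) = 0 := by
  have hc : Real.cos (4 * Real.pi * (j : ℕ) / 5 - 4 * Real.pi * ((j + 1 : Fin 5) : ℕ) / 5) =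
      -(1 + √5) / 4 := by
    rw [← cos_four_pi_div_five]
    by_cases hj : j = 4
    · subst hj
      have : ((4 + 1 : Fin 5) : ℕ) = 0 := rfl
      rw [this, ← Real.cos_sub_nat_mul_two_pi _ 2, ← Real.cos_neg]
      congr 1
      have : ((4 : Fin 5) : ℕ) = 4 := rfl
      rw [this]
      push_cast
      ring
    · have : ((j + 1 : Fin 5) : ℕ) = j + 1 := by revert j; decide
      rw [this, ← Real.cos_neg]
      congr 1
      push_cast
      ring
  have h5 : √5 ≠ (0 : ℝ) := by positivity
  have h55 : √5 * √5 = (5 : ℝ) := Real.mul_self_sqrt (by norm_num)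
  rw [kcbsVec_dot, hc]
  field_simp
  linear_combination (-1 : ℝ) * h55

lemma kcbsProj_mul (i j : Fin 5) : kcbsProj i * kcbsProj j =
    Matrix.of fun a b => ((kcbsVec i a * (kcbsVec i ⬝ᵥ kcbsVec j) * kcbsVec j b : ℝ) : ℂ) := by
  ext a b
  simp only [Matrix.mul_apply, kcbsProj, Matrix.of_apply, dotProduct, Finset.mul_sum,
    Finset.sum_mul]
  push_cast
  exact Finset.sum_congr rfl fun x _ => by ring

lemma kcbsProj_isStarProjection (j : Fin 5) : IsStarProjection (kcbsProj j) where
  isIdempotentElem := by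
    rw [IsIdempotentElem, kcbsProj_mul, kcbsVec_dot_self]
    simp [kcbsProj]
  isSelfAdjoint := by
    rw [IsSelfAdjoint, Matrix.star_eq_conjTranspose]
    ext a b
    simp [kcbsProj, mul_comm]

lemma kcbsProj_mul_succ (j : Fin 5) : kcbsProj j * kcbsProj (j + 1) = 0 := by
  rw [kcbsProj_mul, kcbsVec_dot_succ]
  ext a b
  simp

lemma kcbsProj_succ_mul (j : Fin 5) : kcbsProj (j + 1) * kcbsProj j = 0 := by
  rw [kcbsProj_mul, dotProduct_comm, kcbsVec_dot_succ]
  ext a b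
  simp

lemma binaryPVM_commute {d : ℕ} {P Q : Matrix (Fin d) (Fin d) ℂ} (hP : IsStarProjection P)
    (hQ : IsStarProjection Q) (h : Commute P Q) (a b : Fin 2) :
    Commute ((binaryPVM P hP).proj a) ((binaryPVM Q hQ).proj b) := by
  fin_cases a <;> fin_cases b
  · exact ((Commute.one_left _).sub_left ((Commute.one_right P).sub_right h))
  · exact ((Commute.one_left Q).sub_left h)
  · exact ((Commute.one_right P).sub_right h)
  · exact h

/-- The KCBS scenario: five two-outcome measurements (outcome `1` of measurement `j` is `P_j`),
the contexts being the five adjacent pairs. -/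
noncomputable def kcbsScenario : ProjScenario 3 where
  Meas := Fin 5
  nOut := fun _ => 2
  ctx := Set.range fun j : Fin 5 => ({j, j + 1} : Finset (Fin 5))
  pvm := fun j => binaryPVM (kcbsProj j) (kcbsProj_isStarProjection j)
  compatible := by
    rintro C ⟨n, rfl⟩ i hi j hj a b
    apply binaryPVM_commute
    have h1 : Commute (kcbsProj n) (kcbsProj (n + 1)) := by
      rw [Commute, SemiconjBy, kcbsProj_mul_succ, kcbsProj_succ_mul]
    simp only [Finset.mem_insert, Finset.mem_singleton] at hi hj
    rcases hi with rfl | rfl <;> rcases hj with rfl | rfl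
    · exact Commute.refl _
    · exact h1
    · exact h1.symm
    · exact Commute.refl _

/-- The flag scenario: the single two-outcome measurement of `|0⟩⟨0|` (outcome `1` is the
projection `|0⟩⟨0|`). -/
noncomputable def flagScenario : ProjScenario 3 where
  Meas := Unit
  nOut := fun _ => 2
  ctx := {{()}}
  pvm := fun _ => binaryPVM flagProj flagProj_isStarProjection
  compatible := fun _ _ _ _ _ _ _ _ => binaryPVM_commute _ _ (Commute.refl _) _ _

/-! ## Generalities on local models -/

/-! Locality comes from Werner's model. The hidden variable is a vector `z` of `ℂ³`, distributed
with the Gaussian measure weighted by `|z|² / 3`. Alice answers with the Born probabilities of the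
normalized `z`. Bob refines his measurement to an orthonormal basis and selects the basis vector
with the smallest overlap with `z`. Unitary invariance of the Gaussian makes the correlations depend
only on `Tr P`, `Tr Q` and `Tr (P Q)`, as in a Werner state. They are exactly those of `qutritWerner
(1 - 3 * minMean)` (`isProjectiveLocal_qutritWerner_minMean`). The squared moduli are independent
exponential variables of mean `1`, so their minimum has mean `1/3`; sharing this among three
equivalent outcomes gives `minMean ≤ 1/9`, hence a Werner parameter of at least `2/3`. Mixing with
white noise reaches every smaller nonnegative parameter, in particular `1/2`, and mixing with the
product state `|00⟩⟨00|` gives `ρ`. A compatible context is itself one projective measurement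
(`ProjScenario.blockPVM`), so locality extends to all block statistics.

Entanglement is read off the partial transpose, which is a scalar outside the span of the `|ii⟩` and
a diagonal matrix minus a rank-one matrix on that span.

Noncontextuality is governed by one number: in the state `diag (p, q, q)` all five KCBS projections
have the same probability `κ`. For a normalized state, `κ ≤ 2/5` suffices for a noncontextual model,
by mixing independent sets of the five-cycle (`isNCHVLocal_kcbs`). The marginals satisfy it.
Conditioning on Alice's flag moves weight to `|0⟩` and pushes `κ` beyond `2/5`. A global
noncontextual model would, after weighting by the flag response, obey the five-cycle inequality
`five_cycle_le` in the flagged branch, a contradiction (`not_hasGNCHV_flag_kcbs`). -/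

lemma IsResponse.le_one {Λ O : Type} [MeasurableSpace Λ] [Fintype O] {r : Λ → O → ℝ}
    (h : IsResponse r) (l : Λ) (o : O) : r l o ≤ 1 :=
  (Finset.single_le_sum (f := r l) (fun i _ => h.2.1 l i) (Finset.mem_univ o)).trans_eq (h.2.2 l)

lemma IsResponse.integrable {Λ O : Type} [MeasurableSpace Λ] [Fintype O] {r : Λ → O → ℝ}
    (h : IsResponse r) (μ : Measure Λ) [IsFiniteMeasure μ] (o : O) :
    Integrable (fun l => r l o) μ :=
  Integrable.of_bound (h.1 o).aestronglyMeasurable 1 (Filter.Eventually.of_forall fun l => by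
    rw [Real.norm_eq_abs, abs_of_nonneg (h.2.1 l o)]
    exact h.le_one l o)

lemma IsResponse.integrable_mul {Λ O O' : Type} [MeasurableSpace Λ] [Fintype O] [Fintype O']
    {r : Λ → O → ℝ} {s : Λ → O' → ℝ} (h : IsResponse r) (h' : IsResponse s) (μ : Measure Λ)
    [IsFiniteMeasure μ] (o : O) (o' : O') : Integrable (fun l => r l o * s l o') μ :=
  Integrable.of_bound ((h.1 o).mul (h'.1 o')).aestronglyMeasurable 1
    (Filter.Eventually.of_forall fun l => by
      rw [Real.norm_eq_abs, abs_of_nonneg (mul_nonneg (h.2.1 l o) (h'.2.1 l o'))]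
      exact mul_le_one₀ (h.le_one l o) (h'.2.1 l o') (h'.le_one l o'))

lemma IsResponse.sumElim {Λ₁ Λ₂ O : Type} [MeasurableSpace Λ₁] [MeasurableSpace Λ₂] [Fintype O]
    {r : Λ₁ → O → ℝ} {s : Λ₂ → O → ℝ} (h : IsResponse r) (h' : IsResponse s) :
    IsResponse (Sum.elim r s) := by
  refine ⟨fun o => ?_, ?_, ?_⟩
  · have : (fun l => Sum.elim r s l o) = Sum.elim (fun l => r l o) (fun l => s l o) := by
      funext l; cases l <;> rfl
    rw [this]
    exact (h.1 o).sumElim (h'.1 o)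
  · rintro (l | l) o
    · exact h.2.1 l o
    · exact h'.2.1 l o
  · rintro (l | l)
    · exact h.2.2 l
    · exact h'.2.2 l

/-- Projective locality is preserved under mixing. -/
lemma IsProjectiveLocal.mix {d e : ℕ} {ρ σ : Matrix (Fin d × Fin e) (Fin d × Fin e) ℂ}
    (hρ : IsProjectiveLocal ρ) (hσ : IsProjectiveLocal σ) {s t : ℝ} (hs : 0 ≤ s) (ht : 0 ≤ t)
    (hst : s + t = 1) : IsProjectiveLocal ((s : ℂ) • ρ + (t : ℂ) • σ) := by
  obtain ⟨Λ₁, _, μ₁, rA₁, rB₁, _, hA₁, hB₁, h₁⟩ := hρ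
  obtain ⟨Λ₂, _, μ₂, rA₂, rB₂, _, hA₂, hB₂, h₂⟩ := hσ
  -- The hidden variable also records which component of the mixture was drawn, so both parties
  -- follow the same model.
  refine ⟨Λ₁ ⊕ Λ₂, inferInstance,
    ENNReal.ofReal s • μ₁.map Sum.inl + ENNReal.ofReal t • μ₂.map Sum.inr,
    fun k P => Sum.elim (rA₁ k P) (rA₂ k P), fun k P => Sum.elim (rB₁ k P) (rB₂ k P),
    ⟨?_⟩, fun k P => (hA₁ k P).sumElim (hA₂ k P), fun k P => (hB₁ k P).sumElim (hB₂ k P), ?_⟩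
  · simp [Measure.map_apply measurable_inl MeasurableSet.univ,
      Measure.map_apply measurable_inr MeasurableSet.univ, ← ENNReal.ofReal_add hs ht, hst]
  · intro k l P Q a b
    have m₁ : IsFiniteMeasure (μ₁.map (Sum.inl : Λ₁ → Λ₁ ⊕ Λ₂)) := inferInstance
    have m₂ : IsFiniteMeasure (μ₂.map (Sum.inr : Λ₂ → Λ₁ ⊕ Λ₂)) := inferInstance
    have hi : ∀ μ : Measure (Λ₁ ⊕ Λ₂), IsFiniteMeasure μ → Integrable (fun x =>
        Sum.elim (rA₁ k P) (rA₂ k P) x a * Sum.elim (rB₁ l Q) (rB₂ l Q) x b) μ := fun μ _ =>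
      ((hA₁ k P).sumElim (hA₂ k P)).integrable_mul ((hB₁ l Q).sumElim (hB₂ l Q)) μ a b
    rw [integral_add_measure ((hi _ m₁).smul_measure ENNReal.ofReal_ne_top)
      ((hi _ m₂).smul_measure ENNReal.ofReal_ne_top), integral_smul_measure,
      integral_smul_measure,
      integral_map measurable_inl.aemeasurable (hi _ m₁).aestronglyMeasurable,
      integral_map measurable_inr.aemeasurable (hi _ m₂).aestronglyMeasurable,
      ENNReal.toReal_ofReal hs, ENNReal.toReal_ofReal ht]
    simp only [Sum.elim_inl, Sum.elim_inr, smul_eq_mul]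
    rw [← h₁, ← h₂]
    simp [add_mul, Matrix.trace_add]

lemma trace_mul_nonneg {n : Type} [Fintype n] {σ P : Matrix n n ℂ} (hσ : σ.PosSemidef)
    (hP : IsStarProjection P) : 0 ≤ (σ * P).trace.re := by
  have hh : Pᴴ = P := hP.isSelfAdjoint
  have h : (σ * P).trace = (Pᴴ * σ * P).trace := by
    rw [hh, Matrix.trace_mul_comm (P * σ) P, ← Matrix.mul_assoc, hP.isIdempotentElem.eq,
      Matrix.trace_mul_comm]
  rw [h]
  exact (Complex.le_def.1 (hσ.conjTranspose_mul_mul_same P).trace_nonneg).1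

lemma trace_mul_im {n : Type} [Fintype n] {σ P : Matrix n n ℂ} (hσ : σ.IsHermitian)
    (hP : P.IsHermitian) : (σ * P).trace.im = 0 := by
  have h : star (σ * P).trace = (σ * P).trace := by
    rw [← Matrix.trace_conjTranspose, Matrix.conjTranspose_mul, hσ.eq, hP.eq,
      Matrix.trace_mul_comm]
  exact Complex.conj_eq_iff_im.1 h

lemma PVM.sum_trace_mul {d k : ℕ} (P : PVM d k) {σ : Matrix (Fin d) (Fin d) ℂ}
    (hσ : σ.trace = 1) : ∑ a, (σ * P.proj a).trace.re = 1 := by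
  rw [← Complex.re_sum, ← Matrix.trace_sum, ← Finset.mul_sum, P.sum_eq_one, mul_one, hσ,
    Complex.one_re]

/-- Product states are local. -/
lemma isProjectiveLocal_kronecker {d e : ℕ} {σ : Matrix (Fin d) (Fin d) ℂ}
    {τ : Matrix (Fin e) (Fin e) ℂ} (hσ : IsState σ) (hτ : IsState τ) :
    IsProjectiveLocal (σ ⊗ₖ τ) := by
  refine ⟨Unit, inferInstance, Measure.dirac (), fun k P _ a => (σ * P.proj a).trace.re,
    fun k P _ a => (τ * P.proj a).trace.re, inferInstance,
    fun k P => ⟨fun _ => measurable_const, fun _ a => trace_mul_nonneg hσ.1 (P.isProj a),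
      fun _ => P.sum_trace_mul hσ.2⟩,
    fun k P => ⟨fun _ => measurable_const, fun _ a => trace_mul_nonneg hτ.1 (P.isProj a),
      fun _ => P.sum_trace_mul hτ.2⟩, ?_⟩
  intro k l P Q a b
  -- The real part of the product of traces factors because the trace of a product of two Hermitian
  -- matrices is real.
  rw [← Matrix.mul_kronecker_mul, Matrix.trace_kronecker, Complex.mul_re,
    trace_mul_im hσ.1.isHermitian (P.isProj a).isSelfAdjoint]
  simp

/-! ## Compatible contexts are measured by projective measurements -/

open scoped IsMulCommutative in
-- The projections of one context generate a commutative star subalgebra. Inside it the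
-- noncommutative product of the block projection becomes an ordinary finite product, so that
-- idempotence, self-adjointness and the expansion of a product of sums can be proved there and
-- transported along `f`.
lemma ProjScenario.exists_commRing_model {d : ℕ} (S : ProjScenario d) (C : S.ctx) :
    ∃ (R : Type) (_ : CommRing R) (_ : StarRing R) (f : R →+* Matrix (Fin d) (Fin d) ℂ)
      (p : (j : C.1) → Fin (S.nOut j) → R), Function.Injective f ∧ (∀ x, f (star x) = star (f x)) ∧
      ∀ j a, f (p j a) = (S.pvm j).proj a := by
  let s : Set (Matrix (Fin d) (Fin d) ℂ) := {M | ∃ (j : C.1) (a : Fin (S.nOut j)),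
    M = (S.pvm j).proj a}
  have hs : ∀ a ∈ s, ∀ b ∈ s, a * b = b * a := by
    rintro _ ⟨i, a, rfl⟩ _ ⟨j, b, rfl⟩
    exact S.compatible C.1 C.2 i i.2 j j.2 a b
  have hs' : ∀ a ∈ s, ∀ b ∈ s, a * star b = star b * a := by
    rintro a ha _ ⟨j, b, rfl⟩
    rw [((S.pvm j).isProj b).isSelfAdjoint]
    exact hs _ ha _ ⟨j, b, rfl⟩
  have := StarAlgebra.isMulCommutative_adjoin ℂ hs hs'
  refine ⟨StarAlgebra.adjoin ℂ s, inferInstance, inferInstance,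
    (StarAlgebra.adjoin ℂ s).subtype.toAlgHom.toRingHom,
    fun j a => ⟨(S.pvm j).proj a, StarAlgebra.subset_adjoin ℂ s ⟨j, a, rfl⟩⟩,
    Subtype.val_injective, fun _ => rfl, fun _ _ => rfl⟩

lemma ProjScenario.blockProj_model {d : ℕ} (S : ProjScenario d) (C : S.ctx)
    {R : Type} [CommRing R] (f : R →+* Matrix (Fin d) (Fin d) ℂ)
    (p : (j : C.1) → Fin (S.nOut j) → R) (hp : ∀ j a, f (p j a) = (S.pvm j).proj a)
    (m : S.Block C) : S.blockProj C m = f (∏ j, p j (m j)) := by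
  have h := Finset.map_noncommProd Finset.univ (fun j => p j (m j))
    (fun _ _ _ _ _ => Commute.all _ _) f
  rw [Finset.noncommProd_eq_prod] at h
  exact (Finset.noncommProd_congr rfl (fun j _ => (hp j (m j)).symm) _).trans h.symm

lemma ProjScenario.blockProj_isStarProjection {d : ℕ} (S : ProjScenario d) (C : S.ctx)
    (m : S.Block C) : IsStarProjection (S.blockProj C m) := by
  obtain ⟨R, _, _, f, p, hf, hstar, hp⟩ := S.exists_commRing_model C
  have h : ∀ j a, IsStarProjection (p j a) := fun j a =>
    ⟨hf (by rw [map_mul, hp, ((S.pvm j).isProj a).isIdempotentElem.eq]),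
      hf (by rw [hstar, hp, ((S.pvm j).isProj a).isSelfAdjoint.star_eq])⟩
  rw [S.blockProj_model C f p hp]
  constructor
  · rw [IsIdempotentElem, ← map_mul, ← Finset.prod_mul_distrib]
    exact congrArg f (Finset.prod_congr rfl fun j _ => (h j _).isIdempotentElem.eq)
  · rw [IsSelfAdjoint, ← hstar, star_prod]
    exact congrArg f (Finset.prod_congr rfl fun j _ => (h j _).isSelfAdjoint.star_eq)

open Classical in
lemma ProjScenario.sum_blockProj {d : ℕ} (S : ProjScenario d) (C : S.ctx) :
    ∑ m, S.blockProj C m = 1 := by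
  obtain ⟨R, _, _, f, p, hf, -, hp⟩ := S.exists_commRing_model C
  simp_rw [S.blockProj_model C f p hp]
  rw [← map_sum, ← Fintype.prod_sum fun j a => p j a]
  have : ∀ j, ∑ a, p j a = 1 := fun j => hf (by
    rw [map_sum, map_one, ← (S.pvm j).sum_eq_one]
    exact Finset.sum_congr rfl fun a _ => hp j a)
  simp [this]

open Classical in
/-- The projective measurement of all the measurements in a compatible context. -/
noncomputable def ProjScenario.blockPVM {d : ℕ} (S : ProjScenario d) (C : S.ctx) :
    PVM d (Fintype.card (S.Block C)) where
  proj a := S.blockProj C ((Fintype.equivFin _).symm a)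
  isProj a := S.blockProj_isStarProjection C _
  sum_eq_one := by
    rw [Equiv.sum_comp (Fintype.equivFin (S.Block C)).symm (S.blockProj C), S.sum_blockProj]

/-- Projective locality yields a generalized local hidden-variable model for every family of
pairs of compatible projective contexts. -/
lemma IsProjectiveLocal.hasGLHV {d e : ℕ} {ρ : Matrix (Fin d × Fin e) (Fin d × Fin e) ℂ}
    (hρ : IsProjectiveLocal ρ) (SA : ProjScenario d) (SB : ProjScenario e)
    (tested : Set (SA.ctx × SB.ctx)) :
    HasGLHV SA.toScenario SB.toScenario tested (jointTable SA SB ρ) := by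
  classical
  obtain ⟨Λ, _, μ, rA, rB, hμ, hA, hB, h⟩ := hρ
  have key : ∀ {O : Type} [Fintype O] {r : Λ → Fin (Fintype.card O) → ℝ}, IsResponse r →
      IsResponse fun l o => r l (Fintype.equivFin O o) := fun {O _ r} hr =>
    ⟨fun o => hr.1 _, fun l o => hr.2.1 _ _, fun l => by
      rw [Equiv.sum_comp (Fintype.equivFin O) (r l), hr.2.2]⟩
  refine ⟨Λ, _, μ, fun C l m => rA _ (SA.blockPVM C) l (Fintype.equivFin _ m),
    fun D l m => rB _ (SB.blockPVM D) l (Fintype.equivFin _ m), hμ,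
    fun C => key (hA _ _), fun D => key (hB _ _), ?_⟩
  rintro ⟨C, D⟩ - a b
  rw [← h]
  simp [jointTable, ProjScenario.blockPVM]

/-! ## The complex Gaussian measure -/

/-- The standard Gaussian measure on `ℂ`, with density `exp (-|z|²) / π`. -/
noncomputable def gaussianComplex : Measure ℂ :=
  volume.withDensity fun z => ENNReal.ofReal (Real.exp (-‖z‖ ^ 2) / Real.pi)

lemma measurable_gaussianComplex_density :
    Measurable fun z : ℂ => ENNReal.ofReal (Real.exp (-‖z‖ ^ 2) / Real.pi) := by fun_prop

lemma integral_gaussianComplex (f : ℂ → ℝ) :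
    ∫ z, f z ∂gaussianComplex = ∫ z, Real.exp (-‖z‖ ^ 2) / Real.pi * f z := by
  rw [gaussianComplex, integral_withDensity_eq_integral_toReal_smul
    measurable_gaussianComplex_density (by simp)]
  refine integral_congr_ae (Filter.Eventually.of_forall fun z => ?_)
  simp only [smul_eq_mul]
  rw [ENNReal.toReal_ofReal (by positivity)]

lemma integrable_gaussianComplex_density :
    Integrable fun z : ℂ => Real.exp (-‖z‖ ^ 2) / Real.pi := by
  -- A nonintegrable function has Bochner integral `0` by convention, whereas the closed formula
  -- gives the value `1`.
  by_contra h
  have h1 := Complex.integral_rpow_mul_exp_neg_mul_rpow (p := 2) (q := 0) (b := 1)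
    (by norm_num) (by norm_num) one_pos
  have h2 : ∫ z : ℂ, Real.exp (-‖z‖ ^ 2) / Real.pi = 1 := by
    rw [integral_div]
    norm_num at h1
    rw [h1, div_self Real.pi_ne_zero]
  rw [integral_undef h] at h2
  norm_num at h2

lemma integral_normSq_gaussianComplex : ∫ z, ‖z‖ ^ 2 ∂gaussianComplex = 1 := by
  have h1 := Complex.integral_rpow_mul_exp_neg_mul_rpow (p := 2) (q := 2) (b := 1)
    (by norm_num) (by norm_num) one_pos
  norm_num at h1
  rw [integral_gaussianComplex]
  simp_rw [div_mul_eq_mul_div, mul_comm (Real.exp _)]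
  rw [integral_div, h1, div_self Real.pi_ne_zero]

lemma integrable_normSq_gaussianComplex : Integrable (fun z => ‖z‖ ^ 2) gaussianComplex := by
  by_contra h
  have h1 := integral_normSq_gaussianComplex
  rw [integral_undef h] at h1
  norm_num at h1

instance : IsProbabilityMeasure gaussianComplex := by
  constructor
  have h1 := Complex.integral_rpow_mul_exp_neg_mul_rpow (p := 2) (q := 0) (b := 1)
    (by norm_num) (by norm_num) one_pos
  norm_num at h1
  rw [gaussianComplex, withDensity_apply _ MeasurableSet.univ, Measure.restrict_univ,
    ← ofReal_integral_eq_lintegral_ofReal integrable_gaussianComplex_density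
      (Filter.Eventually.of_forall fun z => by positivity), integral_div, h1,
    div_self Real.pi_ne_zero, ENNReal.ofReal_one]

lemma integral_Ioi_mul_exp_neg_sq (a : ℝ) :
    ∫ y in Set.Ioi a, y * Real.exp (-y ^ 2) = Real.exp (-a ^ 2) / 2 := by
  have hd : ∀ x ∈ Set.Ici a, HasDerivAt (fun y : ℝ => -Real.exp (-y ^ 2) / 2)
      (x * Real.exp (-x ^ 2)) x := fun x _ => by
    have h1 : HasDerivAt (fun y : ℝ => -y ^ 2) (-(2 * x)) x := by
      simpa using (hasDerivAt_pow 2 x).fun_neg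
    exact (h1.exp.fun_neg.div_const 2).congr_deriv (by ring)
  have hi : IntegrableOn (fun y : ℝ => y * Real.exp (-y ^ 2)) (Set.Ioi a) := by
    have := integrable_mul_exp_neg_mul_sq (b := 1) one_pos
    simp only [neg_mul, one_mul] at this
    exact this.integrableOn
  have ht : Filter.Tendsto (fun y : ℝ => -Real.exp (-y ^ 2) / 2) Filter.atTop (nhds 0) := by
    have h1 : Filter.Tendsto (fun y : ℝ => Real.exp (-y ^ 2)) Filter.atTop (nhds 0) :=
      Real.tendsto_exp_neg_atTop_nhds_zero.comp (Filter.tendsto_pow_atTop two_ne_zero)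
    simpa using (h1.neg).div_const 2
  rw [integral_Ioi_of_hasDerivAt_of_tendsto' hd hi ht]
  ring

/-- In polar coordinates the density becomes `2 r exp (-r²)`: the variable `|z|²` is exponential of
mean `1`. -/
lemma gaussianComplex_tail {a : ℝ} (ha : 0 ≤ a) :
    gaussianComplex {z | a < ‖z‖} = ENNReal.ofReal (Real.exp (-a ^ 2)) := by
  have hs : MeasurableSet {z : ℂ | a < ‖z‖} := measurableSet_lt measurable_const measurable_norm
  rw [gaussianComplex, withDensity_apply _ hs, ← ofReal_integral_eq_lintegral_ofReal
    integrable_gaussianComplex_density.integrableOn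
      (Filter.Eventually.of_forall fun z => by positivity), ← integral_indicator hs]
  congr 1
  have h1 : ∀ z : ℂ, Set.indicator {z : ℂ | a < ‖z‖} (fun z => Real.exp (-‖z‖ ^ 2) / Real.pi) z =
      Set.indicator (Set.Ioi a) (fun y => Real.exp (-y ^ 2) / Real.pi) ‖z‖ := fun z => by
    simp [Set.indicator]
  simp_rw [h1]
  rw [integral_fun_norm_addHaar volume
    (Set.indicator (Set.Ioi a) (fun y => Real.exp (-y ^ 2) / Real.pi))]
  have h2 : ∀ y : ℝ, y ^ (Module.finrank ℝ ℂ - 1) •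
      Set.indicator (Set.Ioi a) (fun y => Real.exp (-y ^ 2) / Real.pi) y =
      Set.indicator (Set.Ioi a) (fun y => y * Real.exp (-y ^ 2) / Real.pi) y := fun y => by
    simp [Set.indicator, mul_div_assoc]
  simp_rw [h2]
  rw [setIntegral_indicator measurableSet_Ioi,
    Set.inter_eq_right.2 (Set.Ioi_subset_Ioi ha), integral_div, integral_Ioi_mul_exp_neg_sq]
  have := Real.pi_ne_zero
  simp [Measure.real, Complex.finrank_real_complex, Complex.volume_ball]
  field_simp

/-- The standard Gaussian measure on `ℂ³`. -/
noncomputable def gaussianC3 : Measure (Fin 3 → ℂ) := Measure.pi fun _ => gaussianComplex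

instance : IsProbabilityMeasure gaussianC3 := by unfold gaussianC3; infer_instance

lemma lintegral_fin_nat_prod_eq_prod {n : ℕ} {E : Type} [MeasurableSpace E] (μ : Measure E)
    [SigmaFinite μ] (f : Fin n → E → ENNReal) (hf : ∀ i, Measurable (f i)) :
    ∫⁻ x : Fin n → E, ∏ i, f i (x i) ∂(Measure.pi fun _ => μ) = ∏ i, ∫⁻ z, f i z ∂μ := by
  induction n with
  | zero => simp
  | succ n ih =>
    rw [← ((measurePreserving_piFinSuccAbove (fun _ => μ) 0).symm).lintegral_comp_emb
      (MeasurableEquiv.measurableEmbedding _)]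
    simp_rw [MeasurableEquiv.piFinSuccAbove_symm_apply, Fin.insertNthEquiv, Fin.prod_univ_succ,
      Fin.insertNth_zero, Equiv.coe_fn_mk, Fin.cons_succ, Fin.cons_zero]
    rw [← ih _ fun i => hf _]
    refine lintegral_prod_mul (f := f 0) (g := fun x : Fin n → E => ∏ i : Fin n, f i.succ (x i))
      (hf 0).aemeasurable (Measurable.aemeasurable ?_)
    exact Finset.measurable_prod _ fun i _ => (hf _).comp (measurable_pi_apply i)

/-- The joint density is a function of the Euclidean norm alone, and unitary invariance is deduced
from this form. -/
lemma gaussianC3_eq_withDensity : gaussianC3 = volume.withDensity fun x : Fin 3 → ℂ =>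
    ∏ i, ENNReal.ofReal (Real.exp (-‖x i‖ ^ 2) / Real.pi) := by
  refine Measure.pi_eq fun s hs => ?_
  rw [withDensity_apply _ (MeasurableSet.univ_pi hs), ← lintegral_indicator
    (MeasurableSet.univ_pi hs)]
  have : ∀ x : Fin 3 → ℂ, Set.indicator (Set.univ.pi s)
      (fun x => ∏ i, ENNReal.ofReal (Real.exp (-‖x i‖ ^ 2) / Real.pi)) x =
      ∏ i, Set.indicator (s i) (fun z => ENNReal.ofReal (Real.exp (-‖z‖ ^ 2) / Real.pi)) (x i) := by
    intro x
    by_cases h : ∀ i, x i ∈ s i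
    · rw [Set.indicator_of_mem (by simpa using h)]
      exact Finset.prod_congr rfl fun i _ => by
        rw [Set.indicator_of_mem (h i)]
    · rw [Set.indicator_of_notMem (by simpa using h)]
      push Not at h
      obtain ⟨i, hi⟩ := h
      exact (Finset.prod_eq_zero (Finset.mem_univ i) (Set.indicator_of_notMem hi _)).symm
  simp_rw [this]
  rw [volume_pi, lintegral_fin_nat_prod_eq_prod _ _ fun i =>
    measurable_gaussianComplex_density.indicator (hs i)]
  refine Finset.prod_congr rfl fun i _ => ?_
  rw [lintegral_indicator (hs i), gaussianComplex, withDensity_apply _ (hs i)]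

lemma measurePreserving_unitary_volume {U : Matrix (Fin 3) (Fin 3) ℂ}
    (hU : U ∈ Matrix.unitaryGroup (Fin 3) ℂ) :
    MeasurePreserving (fun z : Fin 3 → ℂ => U *ᵥ z) volume volume := by
  -- As a real map, a complex-linear map has determinant the squared modulus of its complex
  -- determinant, which is `1` for a unitary.
  have hdet : LinearMap.det ((Matrix.toLin' U).restrictScalars ℝ) = 1 := by
    rw [LinearMap.det_restrictScalars, LinearMap.det_toLin', Algebra.norm_complex_apply]
    have := (Matrix.mem_unitaryGroup_iff.1 hU)
    have h2 := congrArg Matrix.det this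
    rw [Matrix.det_mul, Matrix.star_eq_conjTranspose, Matrix.det_conjTranspose, Matrix.det_one]
      at h2
    have h3 := Complex.mul_conj U.det
    rw [← Complex.ofReal_inj, ← h3]
    simpa using h2
  refine ⟨(Matrix.toLin' U).continuous_of_finiteDimensional.measurable, ?_⟩
  have := Measure.map_linearMap_addHaar_eq_smul_addHaar (volume : Measure (Fin 3 → ℂ))
    (f := (Matrix.toLin' U).restrictScalars ℝ) (by rw [hdet]; exact one_ne_zero)
  rw [hdet, inv_one, abs_one, ENNReal.ofReal_one, one_smul] at this
  exact this

lemma sum_normSq_mulVec_unitary {U : Matrix (Fin 3) (Fin 3) ℂ}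
    (hU : U ∈ Matrix.unitaryGroup (Fin 3) ℂ) (z : Fin 3 → ℂ) :
    ∑ i, ‖(U *ᵥ z) i‖ ^ 2 = ∑ i, ‖z i‖ ^ 2 := by
  have key : ∀ v : Fin 3 → ℂ, star v ⬝ᵥ v = ((∑ i, ‖v i‖ ^ 2 : ℝ) : ℂ) := fun v => by
    simp [dotProduct, Complex.conj_mul']
  have : star (U *ᵥ z) ⬝ᵥ (U *ᵥ z) = star z ⬝ᵥ z := by
    rw [Matrix.star_mulVec, Matrix.dotProduct_mulVec, Matrix.vecMul_vecMul,
      ← Matrix.star_eq_conjTranspose, Matrix.mem_unitaryGroup_iff'.1 hU, Matrix.vecMul_one]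
  rw [key, key] at this
  exact_mod_cast this

lemma measurePreserving_unitary {U : Matrix (Fin 3) (Fin 3) ℂ}
    (hU : U ∈ Matrix.unitaryGroup (Fin 3) ℂ) :
    MeasurePreserving (fun z : Fin 3 → ℂ => U *ᵥ z) gaussianC3 gaussianC3 := by
  have hv := measurePreserving_unitary_volume hU
  have hg : Measurable fun x : Fin 3 → ℂ =>
      ∏ i, ENNReal.ofReal (Real.exp (-‖x i‖ ^ 2) / Real.pi) := by fun_prop
  refine ⟨hv.measurable, Measure.ext fun s hs => ?_⟩
  rw [Measure.map_apply hv.measurable hs, gaussianC3_eq_withDensity,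
    withDensity_apply _ (hv.measurable hs), withDensity_apply _ hs,
    ← hv.setLIntegral_comp_preimage hs hg]
  refine lintegral_congr fun z => ?_
  rw [← ENNReal.ofReal_prod_of_nonneg fun i _ => by positivity,
    ← ENNReal.ofReal_prod_of_nonneg fun i _ => by positivity, Finset.prod_div_distrib,
    Finset.prod_div_distrib, ← Real.exp_sum, ← Real.exp_sum, Finset.sum_neg_distrib,
    Finset.sum_neg_distrib, sum_normSq_mulVec_unitary hU]

lemma integrable_normSq_gaussianC3 (i : Fin 3) :
    Integrable (fun z => ‖z i‖ ^ 2) gaussianC3 :=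
  (measurePreserving_eval (fun _ => gaussianComplex) i).integrable_comp_of_integrable
    integrable_normSq_gaussianComplex

lemma integral_normSq_gaussianC3 (i : Fin 3) : ∫ z, ‖z i‖ ^ 2 ∂gaussianC3 = 1 := by
  have h := measurePreserving_eval (fun _ : Fin 3 => gaussianComplex) i
  rw [← integral_normSq_gaussianComplex, ← h.map_eq, integral_map h.measurable.aemeasurable
    (by fun_prop)]
  rfl

/-- By independence, the minimum of three exponential variables of rate `1` is exponential of rate
`3`. -/
lemma gaussianC3_forall_lt {t : ℝ} (ht : 0 ≤ t) :
    gaussianC3 {z | ∀ i, t < ‖z i‖ ^ 2} = ENNReal.ofReal (Real.exp (-3 * t)) := by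
  have h : {z : Fin 3 → ℂ | ∀ i, t < ‖z i‖ ^ 2} =
      Set.univ.pi fun _ => {z : ℂ | √t < ‖z‖} := by
    ext z
    simp [Real.sqrt_lt ht (norm_nonneg _)]
  rw [h, gaussianC3, Measure.pi_pi]
  simp_rw [gaussianComplex_tail (Real.sqrt_nonneg t), Real.sq_sqrt ht]
  rw [Finset.prod_const, ← ENNReal.ofReal_pow (Real.exp_pos _).le, ← Real.exp_nat_mul]
  congr 2
  simp

/-- A nonnegative function bounded by all the `|z_i|²` has Gaussian mean at most `1/3`. -/
lemma integral_le_of_forall_le_normSq {f : (Fin 3 → ℂ) → ℝ} (hf : Integrable f gaussianC3)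
    (h0 : ∀ z, 0 ≤ f z) (hle : ∀ z i, f z ≤ ‖z i‖ ^ 2) : ∫ z, f z ∂gaussianC3 ≤ 1 / 3 := by
  have h1 : ∫⁻ z, ENNReal.ofReal (f z) ∂gaussianC3 ≤ ENNReal.ofReal (1 / 3) := by
    -- Layer cake: `f > t` forces all three squared moduli above `t`, an event of probability `exp
    -- (-3t)`, and these probabilities integrate to `1/3`.
    rw [lintegral_eq_lintegral_meas_lt _ (Filter.Eventually.of_forall h0) hf.aemeasurable]
    have h2 : IntegrableOn (fun t : ℝ => Real.exp (-3 * t)) (Set.Ioi 0) :=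
      exp_neg_integrableOn_Ioi 0 (by norm_num)
    have h3 : ∫ t in Set.Ioi (0 : ℝ), Real.exp (-3 * t) = 1 / 3 := by
      rw [integral_exp_mul_Ioi (by norm_num)]
      norm_num
    rw [← h3, ofReal_integral_eq_lintegral_ofReal h2
      (Filter.Eventually.of_forall fun t => (Real.exp_pos _).le)]
    refine setLIntegral_mono (by fun_prop) fun t ht => ?_
    rw [← gaussianC3_forall_lt (Set.mem_Ioi.1 ht).le]
    exact measure_mono fun z (hz : t < f z) i => hz.trans_le (hle z i)
  rw [integral_eq_lintegral_of_nonneg_ae (Filter.Eventually.of_forall h0)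
    hf.aestronglyMeasurable]
  exact ENNReal.toReal_le_of_le_ofReal (by norm_num) h1

/-! ## The minimizing response -/

open Classical in
/-- The indicator of the event that the `i`-th number is minimal. -/
noncomputable def minInd (x : Fin 3 → ℝ) (i : Fin 3) : ℝ := if ∀ j, x i ≤ x j then 1 else 0

/-- The response that selects a minimal number, ties being resolved uniformly. -/
noncomputable def minResp (x : Fin 3 → ℝ) (i : Fin 3) : ℝ := minInd x i / ∑ j, minInd x j

lemma minInd_nonneg (x : Fin 3 → ℝ) (i : Fin 3) : 0 ≤ minInd x i := by
  unfold minInd; split_ifs <;> norm_num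

lemma sum_minInd_pos (x : Fin 3 → ℝ) : 0 < ∑ j, minInd x j := by
  obtain ⟨i, hi⟩ := Finite.exists_min x
  refine Finset.sum_pos' (fun j _ => minInd_nonneg x j) ⟨i, Finset.mem_univ i, ?_⟩
  rw [minInd, if_pos hi]
  exact one_pos

lemma minResp_nonneg (x : Fin 3 → ℝ) (i : Fin 3) : 0 ≤ minResp x i :=
  div_nonneg (minInd_nonneg x i) (sum_minInd_pos x).le

lemma sum_minResp (x : Fin 3 → ℝ) : ∑ i, minResp x i = 1 := by
  simp_rw [minResp]
  rw [← Finset.sum_div, div_self (sum_minInd_pos x).ne']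

lemma minResp_le_one (x : Fin 3 → ℝ) (i : Fin 3) : minResp x i ≤ 1 :=
  (Finset.single_le_sum (fun j _ => minResp_nonneg x j) (Finset.mem_univ i)).trans_eq
    (sum_minResp x)

/-- Uniform resolution of ties is what makes this equivariance hold at every point, not only almost
everywhere. -/
lemma minResp_comp (x : Fin 3 → ℝ) (σ : Equiv.Perm (Fin 3)) (i : Fin 3) :
    minResp (x ∘ σ) i = minResp x (σ i) := by
  have h : ∀ i, minInd (x ∘ σ) i = minInd x (σ i) := fun i => by
    have : (∀ j, (x ∘ σ) i ≤ (x ∘ σ) j) ↔ ∀ j, x (σ i) ≤ x j :=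
      ⟨fun h j => by simpa using h (σ.symm j), fun h j => h _⟩
    simp only [minInd, this]
  simp only [minResp, h]
  rw [Equiv.sum_comp σ (minInd x)]

/-- Only minimal entries carry weight, so the left side is the minimum of the three numbers. -/
lemma sum_mul_minResp_le (x : Fin 3 → ℝ) (j : Fin 3) : ∑ i, x i * minResp x i ≤ x j := by
  have h : ∀ i, x i * minResp x i ≤ x j * minResp x i := fun i => by
    by_cases hi : ∀ j, x i ≤ x j
    · exact mul_le_mul_of_nonneg_right (hi j) (minResp_nonneg x i)
    · simp [minResp, minInd, if_neg hi]
  calc _ ≤ ∑ i, x j * minResp x i := Finset.sum_le_sum fun i _ => h i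
    _ = x j := by rw [← Finset.mul_sum, sum_minResp, mul_one]

lemma measurable_minResp (i : Fin 3) : Measurable fun x => minResp x i := by
  have h : ∀ i, Measurable fun x => minInd x i := fun i => by
    refine Measurable.ite ?_ measurable_const measurable_const
    simp only [Set.ofPred_forall]
    exact MeasurableSet.iInter fun j => measurableSet_le (measurable_pi_apply i)
      (measurable_pi_apply j)
  exact (h i).div (Finset.measurable_sum _ fun j _ => h j)

/-! ## Second moments of the Gaussian vector, weighted by the minimizing response -/

/-- The squared moduli of the coordinates. -/
noncomputable def sqNorms (z : Fin 3 → ℂ) : Fin 3 → ℝ := fun i => ‖z i‖ ^ 2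

lemma measurable_sqNorms : Measurable sqNorms := by unfold sqNorms; fun_prop

/-- The moment of `conj z_i z_j` weighted by the probability that `b` is selected. -/
noncomputable def minMoment (b i j : Fin 3) : ℂ :=
  ∫ z, star (z i) * z j * (minResp (sqNorms z) b : ℂ) ∂gaussianC3

lemma integrable_minMoment (b i j : Fin 3) :
    Integrable (fun z : Fin 3 → ℂ => star (z i) * z j * (minResp (sqNorms z) b : ℂ))
      gaussianC3 := by
  have hm : Measurable fun z => minResp (sqNorms z) b :=
    (measurable_minResp b).comp measurable_sqNorms
  refine ((integrable_normSq_gaussianC3 i).add (integrable_normSq_gaussianC3 j)).mono'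
    (Measurable.aestronglyMeasurable ?_) (Filter.Eventually.of_forall fun z => ?_)
  · exact ((Complex.continuous_conj.measurable.comp (measurable_pi_apply i)).mul
      (measurable_pi_apply j)).mul (Complex.measurable_ofReal.comp hm)
  rw [norm_mul, norm_mul, norm_star, Complex.norm_real, Real.norm_eq_abs,
    abs_of_nonneg (minResp_nonneg _ _)]
  have := mul_le_of_le_one_right (mul_nonneg (norm_nonneg (z i)) (norm_nonneg (z j)))
    (minResp_le_one (sqNorms z) b)
  simp only [Pi.add_apply]
  nlinarith [sq_nonneg (‖z i‖ - ‖z j‖), sq_nonneg (‖z i‖), sq_nonneg (‖z j‖)]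

lemma minMoment_unitary {U : Matrix (Fin 3) (Fin 3) ℂ} (hU : U ∈ Matrix.unitaryGroup (Fin 3) ℂ)
    (b i j : Fin 3) : minMoment b i j = ∫ z, star ((U *ᵥ z) i) * (U *ᵥ z) j *
      (minResp (sqNorms (U *ᵥ z)) b : ℂ) ∂gaussianC3 := by
  have h := measurePreserving_unitary hU
  rw [minMoment]
  nth_rw 1 [← h.map_eq]
  rw [integral_map h.measurable.aemeasurable]
  rw [h.map_eq]
  exact (integrable_minMoment b i j).aestronglyMeasurable

/-- Changing the sign of the coordinate `i` is unitary and preserves all moduli, hence the selection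
rule, but reverses the sign of the integrand. -/
lemma minMoment_of_ne {b i j : Fin 3} (hij : i ≠ j) : minMoment b i j = 0 := by
  let d : Fin 3 → ℂ := fun k => if k = i then -1 else 1
  have hd : ∀ k, star (d k) * d k = 1 := fun k => by by_cases hk : k = i <;> simp [d, hk]
  have hU : Matrix.diagonal d ∈ Matrix.unitaryGroup (Fin 3) ℂ := by
    rw [Matrix.mem_unitaryGroup_iff', Matrix.star_eq_conjTranspose,
      Matrix.diagonal_conjTranspose, Matrix.diagonal_mul_diagonal, ← Matrix.diagonal_one]
    exact congrArg _ (funext hd)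
  have hs : ∀ z, sqNorms (Matrix.diagonal d *ᵥ z) = sqNorms z := fun z => by
    ext k
    by_cases hk : k = i <;> simp [sqNorms, Matrix.mulVec_diagonal, d, hk]
  have h := minMoment_unitary hU b i j
  simp_rw [hs, Matrix.mulVec_diagonal] at h
  have h2 : minMoment b i j = -minMoment b i j := by
    nth_rw 1 [h]
    rw [minMoment, ← integral_neg]
    refine integral_congr_ae (Filter.Eventually.of_forall fun z => ?_)
    simp [d, hij.symm]
  exact self_eq_neg.1 h2

lemma minMoment_perm (σ : Equiv.Perm (Fin 3)) (b i j : Fin 3) :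
    minMoment b i j = minMoment (σ b) (σ i) (σ j) := by
  have hmv : ∀ z : Fin 3 → ℂ, σ.permMatrix ℂ *ᵥ z = z ∘ σ := fun z => by
    rw [Matrix.permMatrix_mulVec]
  have hU : σ.permMatrix ℂ ∈ Matrix.unitaryGroup (Fin 3) ℂ := by
    rw [Matrix.mem_unitaryGroup_iff', Matrix.star_eq_conjTranspose,
      Matrix.conjTranspose_permMatrix, ← Matrix.permMatrix_mul]
    simp
  have h := minMoment_unitary hU b i j
  have hs : ∀ z, sqNorms (z ∘ σ) = sqNorms z ∘ σ := fun z => rfl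
  simp_rw [hmv, hs, minResp_comp] at h
  exact h

lemma sum_minMoment (i : Fin 3) : ∑ b, minMoment b i i = 1 := by
  simp_rw [minMoment]
  rw [← integral_finsetSum _ fun b _ => integrable_minMoment b i i]
  have : ∀ z : Fin 3 → ℂ, ∑ b, star (z i) * z i * (minResp (sqNorms z) b : ℂ) =
      ((‖z i‖ ^ 2 : ℝ) : ℂ) := fun z => by
    rw [← Finset.mul_sum, ← Complex.ofReal_sum, sum_minResp]
    simp [Complex.conj_mul']
  simp_rw [this]
  rw [integral_complex_ofReal, integral_normSq_gaussianC3, Complex.ofReal_one]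

/-- The mean of the selected squared modulus, for one value of the outcome. -/
noncomputable def minMean : ℝ := ∫ z, ‖z 0‖ ^ 2 * minResp (sqNorms z) 0 ∂gaussianC3

lemma minMoment_self (b : Fin 3) : minMoment b b b = minMean := by
  rw [minMoment_perm (Equiv.swap b 0), Equiv.swap_apply_left, minMean, minMoment,
    ← integral_complex_ofReal]
  refine integral_congr_ae (Filter.Eventually.of_forall fun z => ?_)
  simp [Complex.conj_mul']

/-- The moments of `|z_i|²` over the three outcomes add up to `1`. The outcome `i` contributes
`minMean`, and the two others contribute equally because swapping them fixes `i`. -/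
lemma minMoment_diag_of_ne {b i : Fin 3} (h : i ≠ b) :
    minMoment b i i = ((1 - minMean) / 2 : ℝ) := by
  have key : ∀ c, c ≠ i → minMoment c i i = minMoment b i i := fun c hc => by
    rw [minMoment_perm (Equiv.swap c b), Equiv.swap_apply_left,
      Equiv.swap_apply_of_ne_of_ne hc.symm h]
  have hs := sum_minMoment i
  rw [← Finset.add_sum_erase _ _ (Finset.mem_univ i), minMoment_self,
    Finset.sum_congr rfl fun c hc => key c (Finset.ne_of_mem_erase hc), Finset.sum_const,
    Finset.card_erase_of_mem (Finset.mem_univ i)] at hs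
  simp only [Finset.card_univ, Fintype.card_fin, Nat.add_one_sub_one, nsmul_eq_mul,
    Nat.cast_ofNat] at hs
  push_cast
  linear_combination hs / 2

lemma minMoment_eq (b i j : Fin 3) : minMoment b i j =
    if i = j then (if i = b then (minMean : ℂ) else ((1 - minMean) / 2 : ℝ)) else 0 := by
  split_ifs with h1 h2
  · subst h1 h2; exact minMoment_self i
  · subst h1; exact minMoment_diag_of_ne h2
  · exact minMoment_of_ne h1

/-- The three selected means are equal and sum to the mean of the minimum of the `|z_i|²`, which is
at most `1/3`. -/
lemma minMean_le : minMean ≤ 1 / 9 := by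
  have hi : ∀ b, Integrable (fun z => ‖z b‖ ^ 2 * minResp (sqNorms z) b) gaussianC3 := fun b => by
    refine (integrable_minMoment b b b).norm.congr (Filter.Eventually.of_forall fun z => ?_)
    simp only [norm_mul, norm_star, Complex.norm_real, Real.norm_eq_abs,
      abs_of_nonneg (minResp_nonneg _ _)]
    ring
  have hb : ∀ b, ∫ z, ‖z b‖ ^ 2 * minResp (sqNorms z) b ∂gaussianC3 = minMean := fun b => by
    have h := minMoment_self b
    rw [← Complex.ofReal_inj, ← h, ← integral_complex_ofReal, minMoment]
    refine integral_congr_ae (Filter.Eventually.of_forall fun z => ?_)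
    simp [Complex.conj_mul']
  have h := integral_le_of_forall_le_normSq (integrable_finsetSum Finset.univ fun b _ => hi b)
    (fun z => Finset.sum_nonneg fun b _ => mul_nonneg (sq_nonneg _) (minResp_nonneg _ _))
    fun z j => sum_mul_minResp_le (sqNorms z) j
  rw [integral_finsetSum _ fun b _ => hi b] at h
  simp only [hb, Finset.sum_const, Finset.card_univ, Fintype.card_fin, nsmul_eq_mul] at h
  norm_num at h
  linarith

/-! ## Rank-one refinement of projective measurements -/

/-- Sandwiching the resolution of the identity by `Q_b` shows that the `Q_b Q_c Q_b` with `c ≠ b`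
sum to zero. Their traces are squared Hilbert-Schmidt norms of `Q_c Q_b`, so each of them vanishes.
-/
lemma PVM.proj_mul_proj {d k : ℕ} (Q : PVM d k) {a b : Fin k} (hab : a ≠ b) :
    Q.proj a * Q.proj b = 0 := by
  have hh : ∀ c, (Q.proj c)ᴴ = Q.proj c := fun c => (Q.isProj c).isSelfAdjoint
  have hi : ∀ c, Q.proj c * Q.proj c = Q.proj c := fun c => (Q.isProj c).isIdempotentElem
  have hsq : ∀ c, (Q.proj c * Q.proj b)ᴴ * (Q.proj c * Q.proj b) =
      Q.proj b * Q.proj c * Q.proj b := fun c => by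
    rw [Matrix.conjTranspose_mul, hh, hh, Matrix.mul_assoc, ← Matrix.mul_assoc (Q.proj c), hi,
      Matrix.mul_assoc]
  have hsum : ∑ c ∈ Finset.univ.erase b,
      ((Q.proj c * Q.proj b)ᴴ * (Q.proj c * Q.proj b)).trace = 0 := by
    have h1 : ∑ c, Q.proj b * Q.proj c * Q.proj b = Q.proj b := by
      rw [← Finset.sum_mul, ← Finset.mul_sum, Q.sum_eq_one, mul_one, hi]
    rw [← Finset.add_sum_erase _ _ (Finset.mem_univ b), hi, hi] at h1
    simp_rw [hsq]
    rw [← Matrix.trace_sum, add_eq_left.1 h1, Matrix.trace_zero]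
  have hz := (Finset.sum_eq_zero_iff_of_nonneg fun c _ =>
    (Matrix.posSemidef_conjTranspose_mul_self (Q.proj c * Q.proj b)).trace_nonneg).1 hsum a
    (Finset.mem_erase.2 ⟨hab, Finset.mem_univ a⟩)
  exact Matrix.trace_conjTranspose_mul_self_eq_zero_iff.1 hz

/-- All the projections are functions of the single Hermitian matrix `H = ∑ a Q_a`. Its eigenvalues
are outcome labels, and distinct labels are distinct numbers, so every vector of an eigenbasis lies
in the range of exactly one projection; `f` records which. -/
lemma PVM.exists_unitary {d k : ℕ} (Q : PVM d k) :
    ∃ W ∈ Matrix.unitaryGroup (Fin d) ℂ, ∃ f : Fin d → Fin k, ∀ b,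
      Q.proj b = W * Matrix.diagonal (fun i => if f i = b then 1 else 0) * Wᴴ := by
  set H : Matrix (Fin d) (Fin d) ℂ := ∑ a : Fin k, ((a : ℕ) : ℂ) • Q.proj a with hHdef
  have hH : H.IsHermitian := by
    rw [Matrix.IsHermitian, hHdef, Matrix.conjTranspose_sum]
    refine Finset.sum_congr rfl fun a _ => ?_
    rw [Matrix.conjTranspose_smul, ← Matrix.star_eq_conjTranspose,
      (Q.isProj a).isSelfAdjoint.star_eq]
    simp
  have hQH : ∀ a, Q.proj a * H = ((a : ℕ) : ℂ) • Q.proj a := fun a => by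
    rw [hHdef, Finset.mul_sum, Finset.sum_eq_single a]
    · rw [Matrix.mul_smul, (Q.isProj a).isIdempotentElem.eq]
    · intro b _ hb
      rw [Matrix.mul_smul, Q.proj_mul_proj hb.symm, smul_zero]
    · simp
  set W : Matrix (Fin d) (Fin d) ℂ := (hH.eigenvectorUnitary).1 with hW
  have hWu : W ∈ Matrix.unitaryGroup (Fin d) ℂ := hH.eigenvectorUnitary.2
  let v : Fin d → Fin d → ℂ := fun i => W.col i
  have hHv : ∀ i, H *ᵥ v i = (hH.eigenvalues i : ℂ) • v i := fun i => by
    have := hH.mulVec_eigenvectorBasis i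
    exact this
  have hv0 : ∀ i, v i ≠ 0 := fun i h => by
    have h1 := congrFun (congrFun (Matrix.mem_unitaryGroup_iff'.1 hWu) i) i
    have h2 : ∀ x, W x i = 0 := fun x => congrFun h x
    simp [Matrix.mul_apply, h2] at h1
  have hex : ∀ i, ∃ a, Q.proj a *ᵥ v i ≠ 0 := fun i => by
    by_contra! h
    apply hv0 i
    rw [← Matrix.one_mulVec (v i), ← Q.sum_eq_one, Matrix.sum_mulVec]
    exact Finset.sum_eq_zero fun a _ => h a
  choose f hf using hex
  have hval : ∀ i a, Q.proj a *ᵥ v i ≠ 0 → (hH.eigenvalues i : ℂ) = ((a : ℕ) : ℂ) := by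
    intro i a h
    have h1 : ((a : ℕ) : ℂ) • (Q.proj a *ᵥ v i) =
        (hH.eigenvalues i : ℂ) • (Q.proj a *ᵥ v i) := by
      rw [← Matrix.smul_mulVec, ← hQH, ← Matrix.mulVec_mulVec, hHv, Matrix.mulVec_smul]
    exact (smul_left_injective ℂ h h1).symm
  have hne : ∀ i a, f i ≠ a → Q.proj a *ᵥ v i = 0 := fun i a h => by
    by_contra h'
    have := (hval i _ (hf i)).symm.trans (hval i a h')
    exact h (Fin.ext (by exact_mod_cast this))
  have heq : ∀ i, Q.proj (f i) *ᵥ v i = v i := fun i => by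
    conv_rhs => rw [← Matrix.one_mulVec (v i), ← Q.sum_eq_one, Matrix.sum_mulVec]
    rw [Finset.sum_eq_single (f i) (fun b _ hb => hne i b hb.symm) (by simp)]
  refine ⟨W, hWu, f, fun b => ?_⟩
  have hcol : Q.proj b * W = W * Matrix.diagonal (fun i => if f i = b then 1 else 0) := by
    ext x i
    rw [Matrix.mul_diagonal]
    have hx : (Q.proj b * W) x i = (Q.proj b *ᵥ v i) x := rfl
    rw [hx]
    split_ifs with h
    · subst h
      rw [heq, mul_one]
      rfl
    · rw [hne i b h]
      simp
  rw [← hcol, Matrix.mul_assoc, ← Matrix.star_eq_conjTranspose,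
    Matrix.mem_unitaryGroup_iff.1 hWu, Matrix.mul_one]

/-! ## Werner's local model -/

lemma conjTranspose_mulVec_mulVec {W : Matrix (Fin 3) (Fin 3) ℂ}
    (hW : W ∈ Matrix.unitaryGroup (Fin 3) ℂ) (c : Fin 3 → ℂ) : Wᴴ *ᵥ (W *ᵥ c) = c := by
  rw [Matrix.mulVec_mulVec, ← Matrix.star_eq_conjTranspose, Matrix.mem_unitaryGroup_iff'.1 hW,
    Matrix.one_mulVec]

lemma integral_sum_mul_minResp (R : Fin 3 → Fin 3 → ℂ) (b : Fin 3) :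
    ∫ z, ∑ i, ∑ j, R i j * (star (z i) * z j * (minResp (sqNorms z) b : ℂ)) ∂gaussianC3 =
      (3 * minMean - 1) / 2 * R b b + (1 - minMean) / 2 * ∑ i, R i i := by
  rw [integral_finsetSum _ fun i _ => integrable_finsetSum _ fun j _ =>
    (integrable_minMoment b i j).const_mul _]
  have h : ∀ i, ∫ z, ∑ j, R i j * (star (z i) * z j * (minResp (sqNorms z) b : ℂ)) ∂gaussianC3 =
      ∑ j, R i j * minMoment b i j := fun i => by
    rw [integral_finsetSum _ fun j _ => (integrable_minMoment b i j).const_mul _]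
    exact Finset.sum_congr rfl fun j _ => integral_const_mul _ _
  simp_rw [h, minMoment_eq]
  simp only [mul_ite, mul_zero, Finset.sum_ite_eq, Finset.mem_univ, if_true]
  fin_cases b <;> simp [Fin.sum_univ_three] <;> ring

lemma measurable_quadratic (P : Matrix (Fin 3) (Fin 3) ℂ) :
    Measurable fun z : Fin 3 → ℂ => star z ⬝ᵥ (P *ᵥ z) := by
  unfold dotProduct Matrix.mulVec dotProduct
  simp only [Pi.star_apply]
  fun_prop

lemma measurable_minResp_mulVec (W : Matrix (Fin 3) (Fin 3) ℂ) (i : Fin 3) :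
    Measurable fun z => minResp (sqNorms (W *ᵥ z)) i :=
  (measurable_minResp i).comp (measurable_sqNorms.comp
    (Matrix.mulVecLin W).continuous_of_finiteDimensional.measurable)

/-- The substitution `z = W c` moves Bob's basis to the standard one, where the moments `minMoment`
are known. -/
lemma integral_quadratic_mul_minResp {W : Matrix (Fin 3) (Fin 3) ℂ}
    (hW : W ∈ Matrix.unitaryGroup (Fin 3) ℂ) (P : Matrix (Fin 3) (Fin 3) ℂ) (b : Fin 3) :
    ∫ z, (star z ⬝ᵥ (P *ᵥ z)) * (minResp (sqNorms (Wᴴ *ᵥ z)) b : ℂ) ∂gaussianC3 =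
      (3 * minMean - 1) / 2 * (Wᴴ * P * W) b b + (1 - minMean) / 2 * P.trace := by
  have h := measurePreserving_unitary hW
  have hexp : ∀ c : Fin 3 → ℂ, (star (W *ᵥ c) ⬝ᵥ (P *ᵥ (W *ᵥ c))) *
      (minResp (sqNorms (Wᴴ *ᵥ (W *ᵥ c))) b : ℂ) =
      ∑ i, ∑ j, (Wᴴ * P * W) i j * (star (c i) * c j * (minResp (sqNorms c) b : ℂ)) := fun c => by
    rw [conjTranspose_mulVec_mulVec hW, Matrix.star_mulVec, ← Matrix.dotProduct_mulVec,
      Matrix.mulVec_mulVec, Matrix.mulVec_mulVec, dotProduct,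
      Finset.sum_mul]
    refine Finset.sum_congr rfl fun i _ => ?_
    rw [Matrix.mulVec, dotProduct, Finset.mul_sum, Finset.sum_mul]
    refine Finset.sum_congr rfl fun j _ => ?_
    rw [Pi.star_apply]
    ring
  have htr : (Wᴴ * P * W).trace = P.trace := by
    rw [Matrix.trace_mul_comm, ← Matrix.mul_assoc, ← Matrix.star_eq_conjTranspose,
      Matrix.mem_unitaryGroup_iff.1 hW, Matrix.one_mul]
  have hmap := integral_map (μ := gaussianC3) h.measurable.aemeasurable
    (f := fun z => (star z ⬝ᵥ (P *ᵥ z)) * (minResp (sqNorms (Wᴴ *ᵥ z)) b : ℂ))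
    ((measurable_quadratic P).mul
      (Complex.measurable_ofReal.comp (measurable_minResp_mulVec Wᴴ b))).aestronglyMeasurable
  rw [h.map_eq] at hmap
  rw [hmap]
  simp_rw [hexp]
  rw [← htr]
  exact integral_sum_mul_minResp (Wᴴ * P * W) b

/-- The squared norm of a vector of `ℂ³`. -/
noncomputable def sqNorm (z : Fin 3 → ℂ) : ℝ := ∑ i, ‖z i‖ ^ 2

lemma sqNorm_pos {z : Fin 3 → ℂ} (hz : z ≠ 0) : 0 < sqNorm z := by
  obtain ⟨i, hi⟩ := Function.ne_iff.1 hz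
  exact Finset.sum_pos' (fun j _ => sq_nonneg _)
    ⟨i, Finset.mem_univ i, pow_pos (norm_pos_iff.2 hi) 2⟩

lemma sqNorm_nonneg (z : Fin 3 → ℂ) : 0 ≤ sqNorm z := Finset.sum_nonneg fun _ _ => sq_nonneg _

lemma measurable_sqNorm : Measurable sqNorm := by unfold sqNorm; fun_prop

lemma star_dotProduct_self (z : Fin 3 → ℂ) : star z ⬝ᵥ z = (sqNorm z : ℂ) := by
  simp [dotProduct, sqNorm, Complex.conj_mul']

/-- The hidden variable, replaced by a fixed vector if it vanishes. -/
noncomputable def nonzeroVec (z : Fin 3 → ℂ) : Fin 3 → ℂ := if z = 0 then fun _ => 1 else z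

lemma nonzeroVec_ne_zero (z : Fin 3 → ℂ) : nonzeroVec z ≠ 0 := by
  unfold nonzeroVec
  split_ifs with h
  · exact fun h => one_ne_zero (congrFun h 0)
  · exact h

lemma measurable_nonzeroVec : Measurable nonzeroVec :=
  Measurable.ite (measurableSet_singleton 0) measurable_const measurable_id

/-- The quantum response to a projection. -/
noncomputable def bornResp (P : Matrix (Fin 3) (Fin 3) ℂ) (z : Fin 3 → ℂ) : ℝ :=
  (star (nonzeroVec z) ⬝ᵥ (P *ᵥ nonzeroVec z)).re / sqNorm (nonzeroVec z)

/-- The weight `|z|²` of the hidden-variable distribution cancels the normalization of the Born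
response and leaves a quadratic form. At `z = 0` both sides vanish, so the replacement vector is
harmless. -/
lemma sqNorm_mul_bornResp (P : Matrix (Fin 3) (Fin 3) ℂ) (z : Fin 3 → ℂ) :
    sqNorm z * bornResp P z = (star z ⬝ᵥ (P *ᵥ z)).re := by
  by_cases hz : z = 0
  · simp [hz, sqNorm]
  · rw [bornResp, nonzeroVec, if_neg hz, mul_div_cancel₀ _ (sqNorm_pos hz).ne']

lemma isResponse_bornResp {k : ℕ} (P : PVM 3 k) :
    IsResponse fun z a => bornResp (P.proj a) z := by
  refine ⟨fun a => ?_, fun z a => ?_, fun z => ?_⟩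
  · exact (Complex.measurable_re.comp ((measurable_quadratic _).comp measurable_nonzeroVec)).div
      (measurable_sqNorm.comp measurable_nonzeroVec)
  · have hP : (P.proj a).PosSemidef := by
      have h := Matrix.posSemidef_conjTranspose_mul_self (P.proj a)
      rwa [← Matrix.star_eq_conjTranspose, (P.isProj a).isSelfAdjoint.star_eq,
        (P.isProj a).isIdempotentElem.eq] at h
    exact div_nonneg (Complex.le_def.1 (hP.dotProduct_mulVec_nonneg _)).1 (sqNorm_nonneg _)
  · simp_rw [bornResp]
    rw [← Finset.sum_div, ← Complex.re_sum, ← dotProduct_sum, ← Matrix.sum_mulVec,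
      P.sum_eq_one, Matrix.one_mulVec, star_dotProduct_self, Complex.ofReal_re,
      div_self (sqNorm_pos (nonzeroVec_ne_zero z)).ne']

/-- The distribution of the hidden variable: the Gaussian measure with weight `|z|² / 3`. -/
noncomputable def wernerMeasure : Measure (Fin 3 → ℂ) :=
  gaussianC3.withDensity fun z => ENNReal.ofReal (sqNorm z / 3)

lemma integral_wernerMeasure (f : (Fin 3 → ℂ) → ℝ) :
    ∫ z, f z ∂wernerMeasure = ∫ z, sqNorm z / 3 * f z ∂gaussianC3 := by
  rw [wernerMeasure, integral_withDensity_eq_integral_toReal_smul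
    (measurable_sqNorm.div_const 3).ennreal_ofReal (by simp)]
  refine integral_congr_ae (Filter.Eventually.of_forall fun z => ?_)
  simp only [smul_eq_mul]
  rw [ENNReal.toReal_ofReal (div_nonneg (sqNorm_nonneg z) (by norm_num))]

instance : IsProbabilityMeasure wernerMeasure := by
  constructor
  have hi : Integrable (fun z => sqNorm z / 3) gaussianC3 :=
    (integrable_finsetSum _ fun i _ => integrable_normSq_gaussianC3 i).div_const 3
  rw [wernerMeasure, withDensity_apply _ MeasurableSet.univ, Measure.restrict_univ,
    ← ofReal_integral_eq_lintegral_ofReal hi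
      (Filter.Eventually.of_forall fun z => div_nonneg (sqNorm_nonneg z) (by norm_num)),
    integral_div]
  unfold sqNorm
  rw [integral_finsetSum _ fun i _ => integrable_normSq_gaussianC3 i]
  simp [integral_normSq_gaussianC3]

lemma integrable_quadratic_mul_minResp (W P : Matrix (Fin 3) (Fin 3) ℂ) (b : Fin 3) :
    Integrable (fun z => (star z ⬝ᵥ (P *ᵥ z)) * (minResp (sqNorms (W *ᵥ z)) b : ℂ))
      gaussianC3 := by
  have h1 : ∀ i j : Fin 3, Integrable (fun z : Fin 3 → ℂ => star (z i) * (P i j * z j))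
      gaussianC3 := fun i j => by
    refine (((integrable_normSq_gaussianC3 i).add (integrable_normSq_gaussianC3 j)).const_mul
      ‖P i j‖).mono' (Measurable.aestronglyMeasurable ?_) (Filter.Eventually.of_forall fun z => ?_)
    · exact (Complex.continuous_conj.measurable.comp (measurable_pi_apply i)).mul
        ((measurable_pi_apply j).const_mul _)
    · rw [norm_mul, norm_mul, norm_star, mul_left_comm]
      refine mul_le_mul_of_nonneg_left ?_ (norm_nonneg _)
      simp only [Pi.add_apply]
      nlinarith [sq_nonneg (‖z i‖ - ‖z j‖), sq_nonneg (‖z i‖), sq_nonneg (‖z j‖)]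
  have h2 : Integrable (fun z : Fin 3 → ℂ => star z ⬝ᵥ (P *ᵥ z)) gaussianC3 := by
    unfold dotProduct Matrix.mulVec dotProduct
    simp only [Finset.mul_sum]
    exact integrable_finsetSum _ fun i _ => integrable_finsetSum _ fun j _ => h1 i j
  refine h2.mul_bdd (c := 1)
    (Complex.measurable_ofReal.comp (measurable_minResp_mulVec W b)).aestronglyMeasurable
    (Filter.Eventually.of_forall fun z => ?_)
  rw [Complex.norm_real, Real.norm_eq_abs, abs_of_nonneg (minResp_nonneg _ _)]
  exact minResp_le_one _ _

lemma integral_bornResp_mul_minResp {W : Matrix (Fin 3) (Fin 3) ℂ}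
    (hW : W ∈ Matrix.unitaryGroup (Fin 3) ℂ) (P : Matrix (Fin 3) (Fin 3) ℂ) (b : Fin 3) :
    ∫ z, bornResp P z * minResp (sqNorms (Wᴴ *ᵥ z)) b ∂wernerMeasure =
      (3 * minMean - 1) / 6 * ((Wᴴ * P * W) b b).re + (1 - minMean) / 6 * P.trace.re := by
  have h1 : ∀ z, sqNorm z / 3 * (bornResp P z * minResp (sqNorms (Wᴴ *ᵥ z)) b) =
      RCLike.re ((star z ⬝ᵥ (P *ᵥ z)) * (minResp (sqNorms (Wᴴ *ᵥ z)) b : ℂ)) / 3 := fun z => by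
    rw [RCLike.re_eq_complex_re, Complex.re_mul_ofReal, ← sqNorm_mul_bornResp]
    ring
  rw [integral_wernerMeasure]
  simp_rw [h1]
  rw [integral_div, integral_re (integrable_quadratic_mul_minResp Wᴴ P b),
    integral_quadratic_mul_minResp hW, RCLike.re_eq_complex_re]
  have h2 : (3 * (minMean : ℂ) - 1) / 2 * (Wᴴ * P * W) b b + (1 - minMean) / 2 * P.trace =
      ((((3 * minMean - 1) / 2 : ℝ) : ℂ)) * (Wᴴ * P * W) b b +
        (((1 - minMean) / 2 : ℝ) : ℂ) * P.trace := by
    push_cast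
    ring
  rw [h2, Complex.add_re, Complex.re_ofReal_mul, Complex.re_ofReal_mul]
  ring

lemma trace_swapOp_mul_kronecker (P Q : Matrix (Fin 3) (Fin 3) ℂ) :
    (swapOp * (P ⊗ₖ Q)).trace = (P * Q).trace := by
  have h : ∀ (x : Fin 3 × Fin 3) (M : Matrix (Fin 3 × Fin 3) (Fin 3 × Fin 3) ℂ),
      (swapOp * M) x x = M (x.2, x.1) x := fun x M => by
    rw [Matrix.mul_apply, Finset.sum_eq_single (x.2, x.1)]
    · simp [swapOp]
    · rintro ⟨y₁, y₂⟩ - hy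
      have : ¬ (x.1 = y₂ ∧ x.2 = y₁) := fun h => hy (by rw [h.1, h.2])
      simp [swapOp, this]
    · simp
  simp only [Matrix.trace, Matrix.diag_apply, h, Matrix.kroneckerMap_apply,
    Fintype.sum_prod_type, Matrix.mul_apply]
  rw [Finset.sum_comm]

/-- Only `Tr P`, `Tr Q` and `Tr (P Q)` enter; the averages in Werner's model have the same shape. -/
lemma trace_qutritWerner_mul_kronecker (w : ℝ) (P Q : Matrix (Fin 3) (Fin 3) ℂ) :
    (qutritWerner w * (P ⊗ₖ Q)).trace =
      (w : ℂ) / 6 * (P.trace * Q.trace - (P * Q).trace) + (1 - w) / 9 * (P.trace * Q.trace) := by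
  rw [qutritWerner, antisymProj, add_mul, Matrix.smul_mul, Matrix.smul_mul, Matrix.smul_mul,
    sub_mul, one_mul, Matrix.trace_add, Matrix.trace_smul, Matrix.trace_smul, Matrix.trace_smul,
    Matrix.trace_sub, trace_swapOp_mul_kronecker, Matrix.trace_kronecker]
  simp only [smul_eq_mul]
  ring

lemma IsStarProjection.trace_re {n : Type} [Fintype n] {P : Matrix n n ℂ}
    (hP : IsStarProjection P) : ((P.trace.re : ℝ) : ℂ) = P.trace := by
  classical
  have := trace_mul_im (Matrix.isHermitian_one (n := n) (α := ℂ)) hP.isSelfAdjoint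
  rw [one_mul] at this
  exact Complex.ext rfl (by simpa using this.symm)

/-- Werner's local model for projective measurements. -/
lemma isProjectiveLocal_qutritWerner_minMean :
    IsProjectiveLocal (qutritWerner (1 - 3 * minMean)) := by
  -- The basis and its labelling depend only on Bob's measurement. Bob selects a basis vector of
  -- minimal overlap with `z` and reports the outcome to which that vector belongs.
  choose W hW f hf using fun (k : ℕ) (Q : PVM 3 k) => Q.exists_unitary
  have hB : ∀ k (Q : PVM 3 k), IsResponse fun z b =>
      ∑ i, if f k Q i = b then minResp (sqNorms ((W k Q)ᴴ *ᵥ z)) i else 0 := by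
    refine fun k Q => ⟨fun b => Finset.measurable_sum _ fun i _ => ?_, fun z b =>
      Finset.sum_nonneg fun i _ => ?_, fun z => ?_⟩
    · split_ifs
      · exact measurable_minResp_mulVec _ i
      · exact measurable_const
    · split_ifs
      · exact minResp_nonneg _ _
      · exact le_rfl
    · rw [Finset.sum_comm]
      simp [sum_minResp]
  refine ⟨Fin 3 → ℂ, inferInstance, wernerMeasure, fun k P z a => bornResp (P.proj a) z,
    fun k Q z b => ∑ i, if f k Q i = b then minResp (sqNorms ((W k Q)ᴴ *ᵥ z)) i else 0,
    inferInstance, fun k P => isResponse_bornResp P, hB, ?_⟩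
  intro k l P Q a b
  have hint : ∀ i, Integrable (fun z =>
      bornResp (P.proj a) z * minResp (sqNorms ((W l Q)ᴴ *ᵥ z)) i) wernerMeasure := fun i =>
    (isResponse_bornResp P).integrable_mul (s := fun z i => minResp (sqNorms ((W l Q)ᴴ *ᵥ z)) i)
      ⟨measurable_minResp_mulVec _, fun _ => minResp_nonneg _, fun _ => sum_minResp _⟩ _ a i
  have h1 : ∀ z, bornResp (P.proj a) z *
      ∑ i, (if f l Q i = b then minResp (sqNorms ((W l Q)ᴴ *ᵥ z)) i else 0) =
      ∑ i, (if f l Q i = b then 1 else 0) *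
        (bornResp (P.proj a) z * minResp (sqNorms ((W l Q)ᴴ *ᵥ z)) i) := fun z => by
    rw [Finset.mul_sum]
    refine Finset.sum_congr rfl fun i _ => ?_
    split_ifs <;> simp
  simp_rw [h1]
  rw [integral_finsetSum _ fun i _ => (hint i).const_mul _]
  simp_rw [integral_const_mul, integral_bornResp_mul_minResp (hW l Q)]
  have htQ : (Q.proj b).trace.re = ∑ i, if f l Q i = b then 1 else 0 := by
    rw [hf l Q b, Matrix.mul_assoc, Matrix.trace_mul_comm, Matrix.mul_assoc,
      ← Matrix.star_eq_conjTranspose, Matrix.mem_unitaryGroup_iff'.1 (hW l Q), Matrix.mul_one,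
      Matrix.trace_diagonal, Complex.re_sum]
    exact Finset.sum_congr rfl fun i _ => by split_ifs <;> simp
  have htPQ : (P.proj a * Q.proj b).trace.re =
      ∑ i, (if f l Q i = b then 1 else 0) * (((W l Q)ᴴ * P.proj a * W l Q) i i).re := by
    rw [hf l Q b, ← Matrix.mul_assoc, Matrix.trace_mul_comm, ← Matrix.mul_assoc,
      ← Matrix.mul_assoc, Matrix.trace, Complex.re_sum]
    refine Finset.sum_congr rfl fun i _ => ?_
    rw [Matrix.diag_apply, Matrix.mul_diagonal]
    split_ifs <;> simp
  rw [trace_qutritWerner_mul_kronecker, ← (P.isProj a).trace_re, ← (Q.isProj b).trace_re]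
  -- Matching the coefficient of `Tr (P Q)` forces the parameter `1 - 3 * minMean`; the coefficient
  -- of `Tr P * Tr Q` then agrees as well.
  have h2 : ∀ p q : ℝ, ∀ t : ℂ, (((1 - 3 * minMean : ℝ) : ℂ) / 6 * ((p : ℂ) * q - t) +
      (1 - ((1 - 3 * minMean : ℝ) : ℂ)) / 9 * (p * q)).re =
      (3 * minMean - 1) / 6 * t.re + (1 - minMean) / 6 * p * q := fun p q t => by
    have : ((1 - 3 * minMean : ℝ) : ℂ) / 6 * ((p : ℂ) * q - t) +
      (1 - ((1 - 3 * minMean : ℝ) : ℂ)) / 9 * (p * q) =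
      (((3 * minMean - 1) / 6 : ℝ) : ℂ) * t + (((1 - minMean) / 6 * p * q : ℝ) : ℂ) := by
      push_cast
      ring
    rw [this, Complex.add_re, Complex.re_ofReal_mul, Complex.ofReal_re]
  rw [h2, htPQ, htQ]
  simp_rw [mul_add, Finset.sum_add_distrib, Finset.mul_sum]
  congr 1
  · exact Finset.sum_congr rfl fun i _ => by ring
  · exact Finset.sum_congr rfl fun i _ => by rw [Complex.ofReal_re]; ring

/-! ## Locality of the flagged Werner state -/

lemma isState_single : IsState (Matrix.single (0 : Fin 3) 0 (1 : ℂ)) := by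
  refine ⟨?_, by simp⟩
  have h : Matrix.single (0 : Fin 3) (0 : Fin 3) (1 : ℂ) =
      Matrix.diagonal (Pi.single 0 1) := (Matrix.diagonal_single 0 1).symm
  rw [h]
  refine Matrix.PosSemidef.diagonal fun i => ?_
  fin_cases i <;> simp

lemma isState_uniform : IsState ((1 / 3 : ℂ) • (1 : Matrix (Fin 3) (Fin 3) ℂ)) := by
  refine ⟨Matrix.PosSemidef.one.smul ?_, by simp⟩
  norm_num [Complex.le_def]

lemma qutritWerner_zero : qutritWerner 0 =
    ((1 / 3 : ℂ) • (1 : Matrix (Fin 3) (Fin 3) ℂ)) ⊗ₖ ((1 / 3 : ℂ) • 1) := by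
  rw [Matrix.smul_kronecker, Matrix.kronecker_smul, Matrix.one_kronecker_one, smul_smul,
    qutritWerner]
  norm_num

lemma qutritWerner_mix (s t w : ℝ) (h : s + t = 1) : (s : ℂ) • qutritWerner w +
    (t : ℂ) • qutritWerner 0 = qutritWerner (s * w) := by
  have h' : (t : ℂ) = 1 - s := by
    rw [eq_sub_of_add_eq' h]
    push_cast
    rfl
  simp only [qutritWerner, h', smul_add, smul_smul]
  push_cast
  module

/-- Since `minMean ≤ 1/9`, Werner's model covers a parameter of at least `2/3`. Smaller ones result
from mixing with the maximally mixed state, which is a product. -/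
lemma isProjectiveLocal_qutritWerner {w : ℝ} (h0 : 0 ≤ w) (h1 : w ≤ 2 / 3) :
    IsProjectiveLocal (qutritWerner w) := by
  have hm := minMean_le
  have hpos : 0 < 1 - 3 * minMean := by linarith
  have hw : w / (1 - 3 * minMean) ≤ 1 := (div_le_one hpos).2 (by linarith)
  have h := isProjectiveLocal_qutritWerner_minMean.mix
    (isProjectiveLocal_kronecker isState_uniform isState_uniform)
    (s := w / (1 - 3 * minMean)) (t := 1 - w / (1 - 3 * minMean))
    (div_nonneg h0 hpos.le) (by linarith) (by ring)
  rwa [← qutritWerner_zero, qutritWerner_mix _ _ _ (by ring), div_mul_cancel₀ _ hpos.ne'] at h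

lemma isProjectiveLocal_flaggedWerner {ε w : ℝ} (hε0 : 0 ≤ ε) (hε1 : ε ≤ 1) (h0 : 0 ≤ w)
    (h1 : w ≤ 2 / 3) : IsProjectiveLocal (flaggedWerner ε w) := by
  have h := (isProjectiveLocal_kronecker isState_single isState_single).mix
    (isProjectiveLocal_qutritWerner h0 h1) hε0 (sub_nonneg.2 hε1) (by ring)
  rw [flaggedWerner]
  convert h using 2
  · simp [Matrix.single_kronecker_single]
  · push_cast
    rfl

/-! ## The flagged Werner state as a matrix -/

lemma swapOp_mul_swapOp : swapOp * swapOp = 1 := by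
  ext ⟨a, b⟩ ⟨c, d⟩
  rw [Matrix.mul_apply, Finset.sum_eq_single (b, a)]
  · simp [swapOp, Matrix.one_apply, and_comm]
  · rintro ⟨y₁, y₂⟩ - hy
    have : ¬ (a = y₂ ∧ b = y₁) := fun h => hy (by rw [h.1, h.2])
    simp [swapOp, this]
  · simp

lemma swapOp_isHermitian : swapOpᴴ = swapOp := by
  ext ⟨a, b⟩ ⟨c, d⟩
  simp only [swapOp, Matrix.conjTranspose_apply, Matrix.of_apply]
  by_cases h1 : a = d <;> by_cases h2 : b = c <;> simp [h1, h2, eq_comm]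

lemma antisymProj_posSemidef : antisymProj.PosSemidef := by
  have h : antisymProj = antisymProjᴴ * antisymProj := by
    rw [antisymProj, Matrix.conjTranspose_smul, Matrix.conjTranspose_sub,
      Matrix.conjTranspose_one, swapOp_isHermitian, Matrix.smul_mul, Matrix.mul_smul, smul_smul]
    have : (1 - swapOp) * (1 - swapOp) = (2 : ℂ) • (1 - swapOp) := by
      rw [sub_mul, one_mul, mul_sub, mul_one, swapOp_mul_swapOp]
      module
    rw [this, smul_smul]
    norm_num
  rw [h]
  exact Matrix.posSemidef_conjTranspose_mul_self _

lemma isState_flaggedWerner {ε w : ℝ} (hε0 : 0 ≤ ε) (hε1 : ε ≤ 1) (h0 : 0 ≤ w) (h1 : w ≤ 1) :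
    IsState (flaggedWerner ε w) := by
  have hc : ∀ {x : ℝ}, 0 ≤ x → (0 : ℂ) ≤ x := fun hx => Complex.zero_le_real.2 hx
  constructor
  · have hs : (Matrix.single ((0, 0) : Fin 3 × Fin 3) (0, 0) (1 : ℂ)).PosSemidef := by
      rw [← Matrix.diagonal_single]
      refine Matrix.PosSemidef.diagonal fun i => ?_
      by_cases hi : i = (0, 0)
      · subst hi; simp
      · simp [hi]
    have hw : (qutritWerner w).PosSemidef := by
      refine (antisymProj_posSemidef.smul ?_).add (Matrix.PosSemidef.one.smul ?_)
      · have := hc (div_nonneg h0 (by norm_num : (0 : ℝ) ≤ 3))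
        push_cast at this
        exact this
      · have := hc (div_nonneg (sub_nonneg.2 h1) (by norm_num : (0 : ℝ) ≤ 9))
        push_cast at this
        exact this
    refine (hs.smul (hc hε0)).add (hw.smul ?_)
    have := hc (sub_nonneg.2 hε1)
    push_cast at this
    exact this
  · have h : swapOp.trace = 3 := by
      have := trace_swapOp_mul_kronecker 1 1
      rw [Matrix.one_kronecker_one, mul_one, mul_one, Matrix.trace_one] at this
      simpa using this
    have hq : (qutritWerner w).trace = 1 := by
      rw [qutritWerner, antisymProj]
      simp only [Matrix.trace_add, Matrix.trace_smul, Matrix.trace_sub, h, Matrix.trace_one,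
        smul_eq_mul, Fintype.card_prod, Fintype.card_fin]
      push_cast
      ring
    rw [flaggedWerner, Matrix.trace_add, Matrix.trace_smul, Matrix.trace_smul, hq,
      Matrix.trace_single_eq_same]
    simp

lemma flaggedWerner_half_apply (a b c d : Fin 3) : flaggedWerner (1 / 2) (1 / 2) (a, b) (c, d) =
    (if a = 0 ∧ b = 0 ∧ c = 0 ∧ d = 0 then 1 / 2 else 0) +
      (if a = c ∧ b = d then 5 / 72 else 0) - (if a = d ∧ b = c then 1 / 24 else 0) := by
  have h : (Matrix.single ((0, 0) : Fin 3 × Fin 3) (0, 0) (1 : ℂ)) (a, b) (c, d) =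
      if a = 0 ∧ b = 0 ∧ c = 0 ∧ d = 0 then 1 else 0 := by
    rw [Matrix.single_apply]
    exact if_congr (by simp only [Prod.mk.injEq, eq_comm, and_assoc]) rfl rfl
  simp only [flaggedWerner, qutritWerner, antisymProj, swapOp, Matrix.add_apply,
    Matrix.smul_apply, Matrix.sub_apply, h, Matrix.one_apply, Prod.mk.injEq, Matrix.of_apply,
    smul_eq_mul]
  split_ifs <;> norm_num

lemma marginalA_flaggedWerner :
    marginalA (flaggedWerner (1 / 2) (1 / 2)) = Matrix.diagonal ![2 / 3, 1 / 6, 1 / 6] := by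
  ext i j
  simp only [marginalA, Matrix.of_apply, flaggedWerner_half_apply, Fin.sum_univ_three]
  fin_cases i <;> fin_cases j <;> simp <;> norm_num

lemma marginalB_flaggedWerner :
    marginalB (flaggedWerner (1 / 2) (1 / 2)) = Matrix.diagonal ![2 / 3, 1 / 6, 1 / 6] := by
  ext i j
  simp only [marginalB, Matrix.of_apply, flaggedWerner_half_apply, Fin.sum_univ_three]
  fin_cases i <;> fin_cases j <;> simp <;> norm_num

/-! ## The partial transpose -/

/-- Partial transposition turns the swap into the unnormalized projection onto `∑ |ii⟩`. Only the
span of the `|ii⟩` is therefore affected by more than the scalar `5/72`, which is `(1/2) (w/6 + (1 -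
w)/9)` at `w = 1/2`. -/
lemma partialTranspose_mulVec (v : Fin 3 × Fin 3 → ℂ) (i j : Fin 3) :
    (partialTranspose (flaggedWerner (1 / 2) (1 / 2)) *ᵥ v) (i, j) =
      5 / 72 * v (i, j) + (if i = 0 ∧ j = 0 then 1 / 2 * v (0, 0) else 0) -
        (if i = j then 1 / 24 * (v (0, 0) + v (1, 1) + v (2, 2)) else 0) := by
  simp only [Matrix.mulVec, dotProduct, partialTranspose, Matrix.of_apply,
    flaggedWerner_half_apply, Fintype.sum_prod_type, Fin.sum_univ_three]
  fin_cases i <;> fin_cases j <;> simp <;> ring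

lemma sqrt_177_gt : (37 : ℝ) / 3 < √177 := by
  rw [Real.lt_sqrt (by norm_num)]
  norm_num

/-- On the span of the `|ii⟩` the eigenvalue equation with `k = 5/72 - x` reads `(k + 1/2) v₀₀ =
s/24` and `k v₁₁ = k v₂₂ = s/24`, where `s` is the sum of the three entries. Consistency with `s ≠
0` requires `24k² + 9k - 1 = 0`. The positive root `k = (√177 - 9)/48` gives the eigenvalue, and
scaling to `v₁₁ = 2` gives `v₀₀ = √177 - 13`. -/
lemma hasEigenvector_partialTranspose : Module.End.HasEigenvector
    (Matrix.toLin' (partialTranspose (flaggedWerner (1 / 2) (1 / 2))))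
    (((37 - 3 * √177) / 144 : ℝ) : ℂ)
    (fun x => if x = (0, 0) then (√177 : ℂ) - 13 else if x.1 = x.2 then 2 else 0) := by
  have ht : (√177 : ℂ) * √177 = 177 := by
    rw [← Complex.ofReal_mul, Real.mul_self_sqrt (by norm_num)]
    norm_num
  constructor
  · rw [Module.End.mem_eigenspace_iff, Matrix.toLin'_apply]
    ext ⟨i, j⟩
    rw [partialTranspose_mulVec, Pi.smul_apply, smul_eq_mul]
    push_cast
    fin_cases i <;> fin_cases j <;> simp <;>
      first | ring1 | linear_combination (-1 / 48) * ht | linear_combination (1 / 48) * ht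
  · intro h
    have := congrFun h (1, 1)
    simp at this

lemma isLeast_eigenvalue_partialTranspose : IsLeast {x : ℝ | Module.End.HasEigenvalue
    (Matrix.toLin' (partialTranspose (flaggedWerner (1 / 2) (1 / 2)))) (x : ℂ)}
    ((37 - 3 * √177) / 144) := by
  refine ⟨Module.End.hasEigenvalue_of_hasEigenvector hasEigenvector_partialTranspose, ?_⟩
  intro x hx
  by_contra! hlt
  obtain ⟨v, hv⟩ := hx.exists_hasEigenvector
  have he : ∀ i j, 5 / 72 * v (i, j) + (if i = 0 ∧ j = 0 then 1 / 2 * v (0, 0) else 0) -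
      (if i = j then 1 / 24 * (v (0, 0) + v (1, 1) + v (2, 2)) else 0) = x * v (i, j) :=
    fun i j => by
      rw [← partialTranspose_mulVec, ← Matrix.toLin'_apply, hv.apply_eq_smul]
      rfl
  have ht : √177 * √177 = 177 := Real.mul_self_sqrt (by norm_num)
  have hgt := sqrt_177_gt
  have hk : 0 < 5 / 72 - x := by linarith
  have hk0 : (5 / 72 - x : ℂ) ≠ 0 := by
    have := Complex.ofReal_ne_zero.2 hk.ne'
    push_cast at this
    exact this
  have hk1 : (5 / 72 + 1 / 2 - x : ℂ) ≠ 0 := by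
    have := Complex.ofReal_ne_zero.2 (show 5 / 72 + 1 / 2 - x ≠ 0 by linarith)
    push_cast at this
    exact this
  -- An `x` below the claimed minimum puts `k = 5/72 - x` beyond the larger root of the secular
  -- polynomial, where it is positive.
  have hq : 24 * (5 / 72 - x) ^ 2 + 9 * (5 / 72 - x) - 1 ≠ 0 := by
    have : (√177 - 9) / 48 < 5 / 72 - x := by linarith
    nlinarith
  -- Eliminating the three diagonal entries leaves the secular polynomial times their sum. Once the
  -- sum is zero the equations decouple, with nonzero coefficients, and `v` vanishes.
  have hs : v (0, 0) + v (1, 1) + v (2, 2) = 0 := by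
    have h0 := he 0 0
    have h1 := he 1 1
    have h2 := he 2 2
    simp at h0 h1 h2
    have hq' : (24 * (5 / 72 - x) ^ 2 + 9 * (5 / 72 - x) - 1 : ℂ) ≠ 0 := by
      have := Complex.ofReal_ne_zero.2 hq
      push_cast at this
      exact this
    have : (24 * (5 / 72 - x) ^ 2 + 9 * (5 / 72 - x) - 1 : ℂ) *
        (v (0, 0) + v (1, 1) + v (2, 2)) = 0 := by
      linear_combination 24 * (5 / 72 - x : ℂ) * h0 + 24 * (5 / 72 + 1 / 2 - x : ℂ) * (h1 + h2)
    exact (mul_eq_zero.1 this).resolve_left hq'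
  apply hv.2
  ext ⟨i, j⟩
  have h := he i j
  rw [hs] at h
  simp only [mul_zero, ite_self, sub_zero] at h
  by_cases hij : i = 0 ∧ j = 0
  · rw [if_pos hij, hij.1, hij.2] at h
    have : (5 / 72 + 1 / 2 - x : ℂ) * v (0, 0) = 0 := by linear_combination h
    rw [hij.1, hij.2]
    exact (mul_eq_zero.1 this).resolve_left hk1
  · rw [if_neg hij] at h
    have : (5 / 72 - x : ℂ) * v (i, j) = 0 := by linear_combination h
    exact (mul_eq_zero.1 this).resolve_left hk0

/-- The partial transpose of a separable state is positive. -/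
lemma IsSeparableState.partialTranspose_posSemidef {d e : ℕ}
    {ρ : Matrix (Fin d × Fin e) (Fin d × Fin e) ℂ} (h : IsSeparableState ρ) :
    (partialTranspose ρ).PosSemidef := by
  obtain ⟨n, q, σ, τ, hq, -, hσ, hτ, rfl⟩ := h
  have : partialTranspose (∑ i, (q i : ℂ) • (σ i ⊗ₖ τ i)) =
      ∑ i, (q i : ℂ) • (σ i ⊗ₖ (τ i)ᵀ) := by
    ext x y
    simp [partialTranspose, Matrix.sum_apply]
  rw [this]
  exact Matrix.posSemidef_sum _ fun i _ =>
    ((hσ i).1.kronecker (hτ i).1.transpose).smul (Complex.zero_le_real.2 (hq i))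

lemma not_isSeparableState_of_hasEigenvector {d e : ℕ}
    {ρ : Matrix (Fin d × Fin e) (Fin d × Fin e) ℂ} {x : ℝ} (hx : x < 0)
    {v : Fin d × Fin e → ℂ}
    (hv : Module.End.HasEigenvector (Matrix.toLin' (partialTranspose ρ)) (x : ℂ) v) :
    ¬ IsSeparableState ρ := by
  intro h
  have h1 := h.partialTranspose_posSemidef.dotProduct_mulVec_nonneg v
  rw [← Matrix.toLin'_apply, hv.apply_eq_smul, dotProduct_smul, smul_eq_mul] at h1
  have h2 : 0 < star v ⬝ᵥ v := Matrix.dotProduct_star_self_pos_iff.2 hv.2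
  have h3 : (x : ℂ) * (star v ⬝ᵥ v) < 0 :=
    mul_neg_of_neg_of_pos (by exact_mod_cast hx) h2
  exact absurd (h1.trans_lt h3) (lt_irrefl _)

/-! ## Blocks of one or two measurements -/

lemma prod_subtype_pair {α M : Type} [DecidableEq α] [CommMonoid M] {C : Finset α} {i j : α}
    (hC : C = {i, j}) (hij : i ≠ j) (g : C → M) :
    ∏ x, g x = g ⟨i, by simp [hC]⟩ * g ⟨j, by simp [hC]⟩ := by
  subst hC
  have : (Finset.univ : Finset ({i, j} : Finset α)) = {⟨i, by simp⟩, ⟨j, by simp⟩} := by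
    ext ⟨x, hx⟩
    simp [eq_comm]
  rw [this, Finset.prod_pair (by simpa using hij)]

lemma ProjScenario.blockProj_pair {d : ℕ} (S : ProjScenario d) [DecidableEq S.Meas] (C : S.ctx)
    {i j : S.Meas} (hC : C.1 = {i, j}) (hij : i ≠ j) (m : S.Block C) :
    S.blockProj C m = (S.pvm i).proj (m ⟨i, by simp [hC]⟩) *
      (S.pvm j).proj (m ⟨j, by simp [hC]⟩) := by
  obtain ⟨R, _, _, f, p, -, -, hp⟩ := S.exists_commRing_model C
  rw [S.blockProj_model C f p hp, prod_subtype_pair hC hij, map_mul, hp, hp]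

lemma prod_subtype_singleton {α M : Type} [CommMonoid M] {C : Finset α} {i : α}
    (hC : C = {i}) (g : C → M) : ∏ x, g x = g ⟨i, by simp [hC]⟩ := by
  subst hC
  exact Fintype.prod_eq_single _ fun ⟨x, hx⟩ h => absurd (Subtype.ext (by simpa using hx)) h

lemma ProjScenario.blockProj_singleton {d : ℕ} (S : ProjScenario d) (C : S.ctx)
    {i : S.Meas} (hC : C.1 = {i}) (m : S.Block C) :
    S.blockProj C m = (S.pvm i).proj (m ⟨i, by simp [hC]⟩) := by
  obtain ⟨R, _, _, f, p, -, -, hp⟩ := S.exists_commRing_model C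
  rw [S.blockProj_model C f p hp, prod_subtype_singleton hC, hp]

/-! ## KCBS expectation values in rotationally symmetric diagonal states -/

lemma fin_five_ne_add_one (j : Fin 5) : j ≠ j + 1 := by revert j; decide

lemma kcbsVec_zero_sq (j : Fin 5) : kcbsVec j 0 ^ 2 = 1 / √5 := by
  rw [kcbsVec, Matrix.cons_val_zero, Real.sq_sqrt (by positivity)]

lemma kcbsVec_one_sq_add (j : Fin 5) : kcbsVec j 1 ^ 2 + kcbsVec j 2 ^ 2 = 1 - 1 / √5 := by
  have h := kcbsVec_dot_self j
  simp only [dotProduct, Fin.sum_univ_three] at h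
  linear_combination h - kcbsVec_zero_sq j

/-- The KCBS probability of the state `diag (p, q, q)`. -/
noncomputable def kcbsWeight (p q : ℝ) : ℝ := p / √5 + q * (1 - 1 / √5)

lemma kcbsWeight_eq (p q : ℝ) : kcbsWeight p q = q + (p - q) * √5 / 5 := by
  have h : √5 * √5 = (5 : ℝ) := Real.mul_self_sqrt (by norm_num)
  have h0 : √5 ≠ (0 : ℝ) := by positivity
  rw [kcbsWeight]
  field_simp
  linear_combination (-(p - q)) * h

/-- The probability is the same for all `j`, because the KCBS vectors lie on a cone around `|0⟩` and
the state is symmetric about that axis. -/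
lemma trace_diagonal_mul_kcbsProj (p q : ℝ) (j : Fin 5) :
    (Matrix.diagonal ![(p : ℂ), q, q] * kcbsProj j).trace = kcbsWeight p q := by
  rw [Matrix.trace, Fin.sum_univ_three]
  simp only [Matrix.diag_apply, Matrix.diagonal_mul, kcbsProj, Matrix.of_apply,
    Matrix.cons_val]
  norm_cast
  rw [kcbsWeight]
  linear_combination p * kcbsVec_zero_sq j + q * kcbsVec_one_sq_add j

lemma kcbsObs_mul_kcbsObs_succ (j : Fin 5) : kcbsObs j * kcbsObs (j + 1) =
    1 - (2 : ℂ) • kcbsProj j - (2 : ℂ) • kcbsProj (j + 1) := by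
  rw [kcbsObs, kcbsObs, sub_mul, one_mul, mul_sub, mul_one, Matrix.smul_mul, Matrix.mul_smul,
    kcbsProj_mul_succ]
  simp only [smul_zero, sub_zero]
  abel

lemma expect_kcbsObs_mul (p q : ℝ) (j : Fin 5) :
    expect (Matrix.diagonal ![(p : ℂ), q, q]) (kcbsObs j * kcbsObs (j + 1)) =
      p + 2 * q - 4 * kcbsWeight p q := by
  rw [expect, kcbsObs_mul_kcbsObs_succ, mul_sub, mul_sub, mul_one, Matrix.mul_smul,
    Matrix.mul_smul, Matrix.trace_sub, Matrix.trace_sub, Matrix.trace_smul, Matrix.trace_smul,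
    trace_diagonal_mul_kcbsProj, trace_diagonal_mul_kcbsProj, Matrix.trace_diagonal,
    Fin.sum_univ_three]
  simp
  ring

lemma expect_kcbsOp (p q : ℝ) : expect (Matrix.diagonal ![(p : ℂ), q, q]) kcbsOp =
    5 * (p + 2 * q - 4 * kcbsWeight p q) := by
  have h : expect (Matrix.diagonal ![(p : ℂ), q, q]) kcbsOp =
      ∑ j, expect (Matrix.diagonal ![(p : ℂ), q, q]) (kcbsObs j * kcbsObs (j + 1)) := by
    simp only [expect, kcbsOp, Finset.mul_sum, Matrix.trace_sum, Complex.re_sum]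
  rw [h, Finset.sum_congr rfl fun j _ => expect_kcbsObs_mul p q j]
  simp only [Finset.sum_const, Finset.card_univ, Fintype.card_fin, nsmul_eq_mul, Nat.cast_ofNat]

/-- Each of the five equal correlations lies in `[-3/5, 0]`, so with either sign every term is at
least `-3/5`. -/
lemma satisfiesFiveCycle_diagonal {p q : ℝ} (h0 : p + 2 * q - 4 * kcbsWeight p q ≤ 0)
    (h1 : -3 / 5 ≤ p + 2 * q - 4 * kcbsWeight p q) :
    SatisfiesFiveCycle (Matrix.diagonal ![(p : ℂ), q, q]) := by
  intro γ hγ _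
  simp_rw [expect_kcbsObs_mul]
  have : ∀ j, -3 / 5 ≤ γ j * (p + 2 * q - 4 * kcbsWeight p q) := fun j => by
    rcases hγ j with h | h <;> rw [h] <;> linarith
  calc (-3 : ℝ) = ∑ _j : Fin 5, -3 / 5 := by norm_num
    _ ≤ _ := Finset.sum_le_sum fun j _ => this j

/-! ## Local noncontextuality -/

noncomputable instance : DecidableEq kcbsScenario.Meas := inferInstanceAs (DecidableEq (Fin 5))

lemma mem_left_of_eq_pair {C : Finset (Fin 5)} {j : Fin 5} (hC : C = {j, j + 1}) : j ∈ C := by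
  simp [hC]

lemma mem_right_of_eq_pair {C : Finset (Fin 5)} {j : Fin 5} (hC : C = {j, j + 1}) :
    j + 1 ∈ C := by simp [hC]

/-- Adjacent projections are orthogonal, so the outcome `(1, 1)` never occurs and the single
probability `κ` fixes the whole table. -/
lemma kcbsScenario_localTable {p q : ℝ} (hpq : p + 2 * q = 1) (C : kcbsScenario.ctx) {j : Fin 5}
    (hC : (C.1 : Finset (Fin 5)) = {j, j + 1}) (m : kcbsScenario.Block C) :
    kcbsScenario.localTable (Matrix.diagonal ![(p : ℂ), q, q]) C m =
      (![![1 - 2 * kcbsWeight p q, kcbsWeight p q], ![kcbsWeight p q, 0]] : Fin 2 → Fin 2 → ℝ)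
        (m ⟨j, mem_left_of_eq_pair hC⟩) (m ⟨j + 1, mem_right_of_eq_pair hC⟩) := by
  rw [ProjScenario.localTable, kcbsScenario.blockProj_pair C hC (fin_five_ne_add_one j)]
  generalize m ⟨j, _⟩ = a
  generalize m ⟨j + 1, _⟩ = b
  have h1 : (Matrix.diagonal ![(p : ℂ), q, q]).trace = 1 := by
    rw [Matrix.trace_diagonal, Fin.sum_univ_three]
    simp only [Matrix.cons_val]
    exact_mod_cast (by linarith : p + q + q = 1)
  change (Matrix.diagonal ![(p : ℂ), q, q] * ((![1 - kcbsProj j, kcbsProj j] : Fin 2 → _) a *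
    (![1 - kcbsProj (j + 1), kcbsProj (j + 1)] : Fin 2 → _) b)).trace.re = _
  change Fin 2 at a
  change Fin 2 at b
  have e := trace_diagonal_mul_kcbsProj p q
  have hz := kcbsProj_mul_succ j
  fin_cases a <;> fin_cases b
  · simp [mul_sub, sub_mul, hz, e, h1]
    ring
  · simp [sub_mul, hz, e]
  · simp [mul_sub, hz, e]
  · simp [hz]

/-- The response of the KCBS measurement `j` to the hidden variable: `some i` stands for the
independent set `{i, i + 2}` of the five-cycle, `none` for the empty set. -/
noncomputable def kcbsResp (j : Fin 5) (l : Option (Fin 5)) (a : Fin 2) : ℝ :=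
  if a = (if l = some j ∨ l = some (j + 3) then 1 else 0) then 1 else 0

lemma kcbsResp_nonneg (j : Fin 5) (l : Option (Fin 5)) (a : Fin 2) : 0 ≤ kcbsResp j l a :=
  ite_nonneg zero_le_one le_rfl

/-- Each vertex of the five-cycle belongs to exactly two of the sets `{i, i + 2}`, and none of these
sets contains adjacent vertices. Weight `κ/2` on each set thus gives probability `κ` to every vertex
and `0` to every edge. -/
lemma sum_kcbsResp_mul (κ : ℝ) (j : Fin 5) (a b : Fin 2) :
    (1 - 5 * κ / 2) * (kcbsResp j none a * kcbsResp (j + 1) none b) +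
      ∑ i, κ / 2 * (kcbsResp j (some i) a * kcbsResp (j + 1) (some i) b) =
      (![![1 - 2 * κ, κ], ![κ, 0]] : Fin 2 → Fin 2 → ℝ) a b := by
  simp only [kcbsResp, Fin.sum_univ_five]
  fin_cases j <;> fin_cases a <;> fin_cases b <;> simp <;> ring

lemma isNCHVLocal_kcbs {p q : ℝ} (hpq : p + 2 * q = 1) (h0 : 0 ≤ kcbsWeight p q)
    (h1 : kcbsWeight p q ≤ 2 / 5) : IsNCHVLocal kcbsScenario.toScenario
      (kcbsScenario.localTable (Matrix.diagonal ![(p : ℂ), q, q])) := by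
  set κ := kcbsWeight p q with hκ
  -- The five sets use up `5κ/2`. The remainder on the empty set is nonnegative exactly when `κ ≤
  -- 2/5`.
  let w : Option (Fin 5) → ℝ := fun l => l.elim (1 - 5 * κ / 2) fun _ => κ / 2
  have hw : ∀ l, 0 ≤ w l := by
    rintro (_ | i)
    · change 0 ≤ 1 - 5 * κ / 2
      linarith
    · change 0 ≤ κ / 2
      linarith
  let P : PMF (Option (Fin 5)) := PMF.ofFintype (fun l => ENNReal.ofReal (w l)) (by
    rw [← ENNReal.ofReal_sum_of_nonneg fun l _ => hw l, Fintype.sum_option]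
    simp only [w, Option.elim_none, Option.elim_some, Finset.sum_const, Finset.card_univ,
      Fintype.card_fin, nsmul_eq_mul]
    rw [show 1 - 5 * κ / 2 + ((5 : ℕ) : ℝ) * (κ / 2) = 1 by push_cast; ring, ENNReal.ofReal_one])
  let _ : MeasurableSpace (Option (Fin 5)) := ⊤
  refine ⟨Option (Fin 5), ⊤, P.toMeasure, kcbsResp, inferInstance, fun j => ⟨fun a => ?_,
    fun l a => ?_, fun l => ?_⟩, ?_⟩
  · exact measurable_from_top
  · exact kcbsResp_nonneg j l a
  · change ∑ a : Fin 2, kcbsResp j l a = 1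
    simp [kcbsResp]
  · intro C m
    obtain ⟨j, hj⟩ := C.2
    rw [kcbsScenario_localTable hpq C hj.symm m]
    have hprod : ∀ l, ∏ k : C.1, kcbsResp k.1 l (m k) = _ := fun l =>
      prod_subtype_pair hj.symm (fin_five_ne_add_one j) fun k => kcbsResp k.1 l (m k)
    simp_rw [hprod]
    rw [PMF.integral_eq_sum, Fintype.sum_option]
    have hP : ∀ l, (P l).toReal = w l := fun l => ENNReal.toReal_ofReal (hw l)
    simp_rw [hP]
    exact (sum_kcbsResp_mul κ j _ _).symm

lemma isNCHVLocal_flag {σ : Matrix (Fin 3) (Fin 3) ℂ} (hσ : IsState σ) :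
    IsNCHVLocal flagScenario.toScenario (flagScenario.localTable σ) := by
  refine ⟨Unit, inferInstance, Measure.dirac (),
    fun j _ a => (σ * (flagScenario.pvm j).proj a).trace.re, inferInstance,
    fun j => ⟨fun _ => measurable_const, fun _ a =>
      trace_mul_nonneg hσ.1 ((flagScenario.pvm j).isProj a),
      fun _ => (flagScenario.pvm j).sum_trace_mul hσ.2⟩, ?_⟩
  intro C m
  have hC : C.1 = {()} := C.2
  rw [integral_const, ProjScenario.localTable, flagScenario.blockProj_singleton C hC,
    prod_subtype_singleton hC]
  simp

/-! ## The flag outcome -/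

lemma flagProj_kronecker_one : flagProj ⊗ₖ (1 : Matrix (Fin 3) (Fin 3) ℂ) =
    Matrix.diagonal fun x : Fin 3 × Fin 3 => if x.1 = 0 then 1 else 0 := by
  have h : flagProj = Matrix.diagonal fun a : Fin 3 => if a = 0 then (1 : ℂ) else 0 := by
    ext a b
    fin_cases a <;> fin_cases b <;> simp [flagProj]
  rw [h, ← Matrix.diagonal_one, Matrix.diagonal_kronecker_diagonal]
  simp

lemma marginalB_flag_flaggedWerner :
    marginalB ((flagProj ⊗ₖ (1 : Matrix (Fin 3) (Fin 3) ℂ)) * flaggedWerner (1 / 2) (1 / 2) *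
      (flagProj ⊗ₖ (1 : Matrix (Fin 3) (Fin 3) ℂ))) =
      Matrix.diagonal ![((19 / 36 : ℝ) : ℂ), (5 / 72 : ℝ), (5 / 72 : ℝ)] := by
  ext i j
  simp only [flagProj_kronecker_one, marginalB, Matrix.of_apply, Matrix.mul_diagonal,
    Matrix.diagonal_mul, flaggedWerner_half_apply, Fin.sum_univ_three]
  fin_cases i <;> fin_cases j <;> (simp; try norm_num)

lemma trace_mul_one_kronecker {d e : ℕ} (M : Matrix (Fin d × Fin e) (Fin d × Fin e) ℂ)
    (X : Matrix (Fin e) (Fin e) ℂ) :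
    (M * ((1 : Matrix (Fin d) (Fin d) ℂ) ⊗ₖ X)).trace = (marginalB M * X).trace := by
  simp only [Matrix.trace, Matrix.diag_apply, Matrix.mul_apply, marginalB, Matrix.of_apply,
    Fintype.sum_prod_type, Matrix.kroneckerMap_apply, Matrix.one_apply, Finset.sum_mul]
  rw [Finset.sum_comm]
  refine Finset.sum_congr rfl fun i _ => ?_
  symm
  rw [Finset.sum_comm]
  refine Finset.sum_congr rfl fun k _ => ?_
  symm
  rw [Finset.sum_eq_single k (fun k' _ hk => by simp [hk]) (by simp)]
  simp

/-- Everything Bob observes jointly with the flag is governed by the unnormalized conditional state,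
whose trace `2/3` is the probability of the flag. -/
lemma trace_flaggedWerner_mul_flag (X : Matrix (Fin 3) (Fin 3) ℂ) :
    (flaggedWerner (1 / 2) (1 / 2) * (flagProj ⊗ₖ X)).trace =
      (Matrix.diagonal ![((19 / 36 : ℝ) : ℂ), (5 / 72 : ℝ), (5 / 72 : ℝ)] * X).trace := by
  have hF : flagProj ⊗ₖ X = (flagProj ⊗ₖ (1 : Matrix (Fin 3) (Fin 3) ℂ)) * (1 ⊗ₖ X) *
      (flagProj ⊗ₖ (1 : Matrix (Fin 3) (Fin 3) ℂ)) := by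
    rw [← Matrix.mul_kronecker_mul, ← Matrix.mul_kronecker_mul, mul_one, one_mul, mul_one,
      flagProj_isStarProjection.isIdempotentElem.eq]
  rw [← marginalB_flag_flaggedWerner, ← trace_mul_one_kronecker, hF, ← Matrix.mul_assoc,
    Matrix.trace_mul_comm, ← Matrix.mul_assoc, ← Matrix.mul_assoc]

lemma probA_flaggedWerner : probA (flaggedWerner (1 / 2) (1 / 2)) flagProj = 2 / 3 := by
  rw [probA, trace_flaggedWerner_mul_flag, mul_one, Matrix.trace_diagonal, Fin.sum_univ_three]
  simp only [Matrix.cons_val, ← Complex.ofReal_add, Complex.ofReal_re]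
  norm_num

lemma conditionalB_flaggedWerner : conditionalB (flaggedWerner (1 / 2) (1 / 2)) flagProj =
    Matrix.diagonal ![19 / 24, 5 / 48, 5 / 48] := by
  rw [conditionalB, probA_flaggedWerner, marginalB_flag_flaggedWerner, ← Matrix.diagonal_smul]
  congr 1
  ext i
  fin_cases i <;> simp <;> norm_num

/-! ## No global noncontextual model -/

/-- A cyclic sequence of five bits has at most two descents. For values in `[0, 1]` the expression
is affine in `x₀`, so it suffices to check `x₀ = 0` (`hz`) and `x₀ = 1` (`ho`), where the deficit
from `2` is a sum of the nonnegative products supplied to `nlinarith`. -/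
lemma five_cycle_le {x₀ x₁ x₂ x₃ x₄ : ℝ} (h₀ : 0 ≤ x₀) (h₀' : x₀ ≤ 1) (h₁ : 0 ≤ x₁)
    (h₁' : x₁ ≤ 1) (h₂ : 0 ≤ x₂) (h₂' : x₂ ≤ 1) (h₃ : 0 ≤ x₃) (h₃' : x₃ ≤ 1) (h₄ : 0 ≤ x₄)
    (h₄' : x₄ ≤ 1) : x₀ * (1 - x₁) + x₁ * (1 - x₂) + x₂ * (1 - x₃) + x₃ * (1 - x₄) +
      x₄ * (1 - x₀) ≤ 2 := by
  have hz : x₁ * (1 - x₂) + x₂ * (1 - x₃) + x₃ * (1 - x₄) + x₄ ≤ 2 := by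
    nlinarith [mul_nonneg (sub_nonneg.2 h₁') (sub_nonneg.2 h₂'), mul_nonneg h₂ h₃,
      mul_nonneg (sub_nonneg.2 h₃') (sub_nonneg.2 h₄')]
  have ho : 1 - x₁ + x₁ * (1 - x₂) + x₂ * (1 - x₃) + x₃ * (1 - x₄) ≤ 2 := by
    nlinarith [mul_nonneg h₁ h₂, mul_nonneg (sub_nonneg.2 h₂') (sub_nonneg.2 h₃'),
      mul_nonneg h₃ h₄]
  nlinarith [mul_le_mul_of_nonneg_left hz (sub_nonneg.2 h₀'), mul_le_mul_of_nonneg_left ho h₀]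

lemma sqrt_five_bounds : (2.23 : ℝ) < √5 ∧ √5 < 2.24 := by
  constructor
  · rw [Real.lt_sqrt (by norm_num)]
    norm_num
  · rw [Real.sqrt_lt' (by norm_num)]
    norm_num

/-- The only context of the flag scenario. -/
noncomputable def flagCtx : flagScenario.ctx := ⟨{()}, rfl⟩

/-- The `j`-th context of the KCBS scenario. -/
noncomputable def kcbsCtx (j : Fin 5) : kcbsScenario.ctx := ⟨({j, j + 1} : Finset (Fin 5)), j, rfl⟩

/-- The flag outcome as a block. -/
noncomputable def flagBlock : flagScenario.Block flagCtx.1 := fun _ => (1 : Fin 2)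

/-- The outcome `1` for the measurement `j`, and `0` for the other ones. -/
def onlyOutcome (j k : Fin 5) : Fin 2 := if k = j then 1 else 0

/-- The block in which the measurement `j` has outcome `1` and `j + 1` has outcome `0`. -/
noncomputable def kcbsBlock (j : Fin 5) : kcbsScenario.Block (kcbsCtx j).1 :=
  fun k => onlyOutcome j k.1

lemma onlyOutcome_self (j : Fin 5) : onlyOutcome j j = 1 := if_pos rfl

lemma onlyOutcome_succ (j : Fin 5) : onlyOutcome j (j + 1) = 0 :=
  if_neg (fin_five_ne_add_one j).symm

lemma blockProj_flagBlock : flagScenario.blockProj flagCtx flagBlock = flagProj :=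
  flagScenario.blockProj_singleton flagCtx rfl flagBlock

lemma blockProj_kcbsBlock (j : Fin 5) : kcbsScenario.blockProj (kcbsCtx j) (kcbsBlock j) =
    kcbsProj j * (1 - kcbsProj (j + 1)) := by
  have h : kcbsScenario.blockProj (kcbsCtx j) (kcbsBlock j) =
      (![1 - kcbsProj j, kcbsProj j] : Fin 2 → _) (onlyOutcome j j) *
        (![1 - kcbsProj (j + 1), kcbsProj (j + 1)] : Fin 2 → _) (onlyOutcome j (j + 1)) :=
    kcbsScenario.blockProj_pair (kcbsCtx j) rfl (fin_five_ne_add_one j) (kcbsBlock j)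
  rw [h, onlyOutcome_self, onlyOutcome_succ]
  rfl

lemma jointTable_flag_kcbs (j : Fin 5) :
    jointTable flagScenario kcbsScenario (flaggedWerner (1 / 2) (1 / 2)) flagCtx (kcbsCtx j)
      flagBlock (kcbsBlock j) = kcbsWeight (19 / 36) (5 / 72) := by
  unfold jointTable
  rw [blockProj_flagBlock, blockProj_kcbsBlock, mul_sub, mul_one, kcbsProj_mul_succ, sub_zero,
    trace_flaggedWerner_mul_flag, trace_diagonal_mul_kcbsProj, Complex.ofReal_re]

open Classical in
lemma sum_jointTable_flag (D : kcbsScenario.ctx) : ∑ b, jointTable flagScenario kcbsScenario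
    (flaggedWerner (1 / 2) (1 / 2)) flagCtx D flagBlock b = 2 / 3 := by
  unfold jointTable
  rw [← Complex.re_sum, ← Matrix.trace_sum, ← Finset.mul_sum]
  have h : ∀ A : Matrix (Fin 3) (Fin 3) ℂ, ∑ b, A ⊗ₖ kcbsScenario.blockProj D b = A ⊗ₖ 1 :=
    fun A => by
      rw [← kcbsScenario.sum_blockProj D]
      ext x y
      simp only [Matrix.sum_apply, Matrix.kroneckerMap_apply, Finset.mul_sum]
      congr!
  rw [h, blockProj_flagBlock]
  exact probA_flaggedWerner

lemma not_hasGNCHV_flag_kcbs : ¬ HasGNCHV flagScenario.toScenario kcbsScenario.toScenario Set.univ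
    (jointTable flagScenario kcbsScenario (flaggedWerner (1 / 2) (1 / 2))) := by
  classical
  rintro ⟨Λ, _, μ, rA, rB, hμ, hA, hB, h⟩
  let f : Λ → ℝ := fun l => rA () l (1 : Fin 2)
  let r : Fin 5 → Λ → Fin 2 → ℝ := rB
  have hr : ∀ j, IsResponse (r j) := hB
  let x : Fin 5 → Λ → ℝ := fun j l => r j l 1
  have hf0 : ∀ l, 0 ≤ f l := fun l => (hA ()).2.1 l _
  have hfi : Integrable f μ := (hA ()).integrable μ _
  have hx0 : ∀ j l, 0 ≤ x j l := fun j l => (hr j).2.1 l _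
  have hx1 : ∀ j l, x j l ≤ 1 := fun j l => (hr j).le_one l _
  have hx' : ∀ j l, r j l 0 = 1 - x j l := fun j l => by
    have := (hr j).2.2 l
    rw [Fin.sum_univ_two] at this
    exact eq_sub_of_add_eq this
  have hpA : ∀ l, ∏ j : flagCtx.1, rA j.1 l (flagBlock j) = f l := fun l =>
    prod_subtype_singleton (i := ()) rfl fun j : flagCtx.1 => rA j.1 l (flagBlock j)
  -- Noncontextuality enters here: the same function `x (j + 1)` serves the contexts `{j, j + 1}`
  -- and `{j + 1, j + 2}`.
  have hpB : ∀ j l, ∏ k : (kcbsCtx j).1, rB k.1 l (kcbsBlock j k) = x j l * (1 - x (j + 1) l) :=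
    fun j l => by
      have : ∏ k : (kcbsCtx j).1, rB k.1 l (kcbsBlock j k) =
          r j l (onlyOutcome j j) * r (j + 1) l (onlyOutcome j (j + 1)) :=
        prod_subtype_pair (C := ({j, j + 1} : Finset (Fin 5))) rfl (fin_five_ne_add_one j)
          fun k => r k.1 l (onlyOutcome j k.1)
      rw [this, onlyOutcome_self, onlyOutcome_succ, hx']
  have hterm : ∀ j, ∫ l, f l * (x j l * (1 - x (j + 1) l)) ∂μ = kcbsWeight (19 / 36) (5 / 72) :=
    fun j => by
      rw [← jointTable_flag_kcbs j, h (flagCtx, kcbsCtx j) (Set.mem_univ _)]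
      simp_rw [hpA, hpB]
  -- The flag is tested only together with a KCBS context, so its mean is recovered by summing over
  -- Bob's outcomes in one of them.
  have hmean : ∫ l, f l ∂μ = 2 / 3 := by
    let D := kcbsCtx 0
    have hsum : ∀ l, ∑ b : kcbsScenario.Block D.1, ∏ k : D.1, rB k.1 l (b k) = 1 := fun l => by
      rw [← Fintype.prod_sum fun (k : D.1) a => rB k.1 l a]
      exact Finset.prod_eq_one fun k _ => (hB k.1).2.2 l
    have hi : ∀ b : kcbsScenario.Block D.1,
        Integrable (fun l => f l * ∏ k : D.1, rB k.1 l (b k)) μ := fun b =>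
      (hA ()).integrable_mul (s := fun l b => ∏ k : D.1, rB k.1 l (b k))
        ⟨fun b => Finset.measurable_prod _ fun k _ => (hB k.1).1 _,
          fun l b => Finset.prod_nonneg fun k _ => (hB k.1).2.1 l _, hsum⟩ μ _ b
    have e : ∀ b, jointTable flagScenario kcbsScenario (flaggedWerner (1 / 2) (1 / 2)) flagCtx D
        flagBlock b = ∫ l, f l * ∏ k : D.1, rB k.1 l (b k) ∂μ := fun b => by
      rw [h (flagCtx, D) (Set.mem_univ _)]
      simp_rw [hpA]
    have hs := sum_jointTable_flag D
    rw [Finset.sum_congr rfl fun b _ => e b, ← integral_finsetSum _ fun b _ => hi b] at hs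
    rw [← hs]
    refine integral_congr_ae (Filter.Eventually.of_forall fun l => ?_)
    simp only
    rw [← Finset.mul_sum]
    have := hsum l
    rw [show (∑ b : kcbsScenario.Block D.1, ∏ k : D.1, rB k.1 l (b k)) = 1 by convert this,
      mul_one]
  have hxm : ∀ j, Measurable (x j) := fun j => (hr j).1 _
  have hint : ∀ j, Integrable (fun l => f l * (x j l * (1 - x (j + 1) l))) μ := fun j => by
    refine hfi.mono (hfi.aestronglyMeasurable.mul
      ((hxm j).mul ((hxm _).const_sub 1)).aestronglyMeasurable)
      (Filter.Eventually.of_forall fun l => ?_)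
    rw [Real.norm_eq_abs, Real.norm_eq_abs, abs_of_nonneg (hf0 l), abs_of_nonneg
      (mul_nonneg (hf0 l) (mul_nonneg (hx0 _ _) (sub_nonneg.2 (hx1 _ _))))]
    exact mul_le_of_le_one_right (hf0 l) (mul_le_one₀ (hx1 _ _) (sub_nonneg.2 (hx1 _ _))
      (by linarith [hx0 (j + 1) l]))
  have hle : ∫ l, ∑ j, f l * (x j l * (1 - x (j + 1) l)) ∂μ ≤ ∫ l, f l * 2 ∂μ := by
    refine integral_mono (integrable_finsetSum _ fun j _ => hint j) (hfi.mul_const 2) fun l => ?_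
    simp only
    rw [← Finset.mul_sum, Fin.sum_univ_five]
    exact mul_le_mul_of_nonneg_left (five_cycle_le (hx0 0 l) (hx1 0 l) (hx0 1 l) (hx1 1 l)
      (hx0 2 l) (hx1 2 l) (hx0 3 l) (hx1 3 l) (hx0 4 l) (hx1 4 l)) (hf0 l)
  -- The inequality becomes `5κ ≤ 4/3` with `5κ = (25 + 33√5)/72`, that is `√5 ≤ 71/33`, which is
  -- false.
  rw [integral_finsetSum _ fun j _ => hint j, integral_mul_const, hmean,
    Finset.sum_congr rfl fun j _ => hterm j, kcbsWeight_eq] at hle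
  simp only [Finset.sum_const, Finset.card_univ, Fintype.card_fin, nsmul_eq_mul] at hle
  have := sqrt_five_bounds.1
  norm_num at hle
  linarith

theorem mainTheorem3 (ρ : Matrix (Fin 3 × Fin 3) (Fin 3 × Fin 3) ℂ)
    (hρ : ρ = flaggedWerner (1 / 2) (1 / 2)) :
    -- `ρ` is a state, local for all projective measurements
    IsState ρ ∧ IsProjectiveLocal ρ ∧
    -- generalized locality for all scenarios of compatible projective contexts
    (∀ (SA SB : ProjScenario 3) (tested : Set (SA.ctx × SB.ctx)),
      HasGLHV SA.toScenario SB.toScenario tested (jointTable SA SB ρ)) ∧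
    -- `ρ` is NPT, with the stated smallest eigenvalue of the partial transpose, and entangled
    IsLeast {x : ℝ | Module.End.HasEigenvalue (Matrix.toLin' (partialTranspose ρ)) (x : ℂ)}
      ((37 - 3 * √177) / 144) ∧
    (37 - 3 * √177) / 144 < 0 ∧
    ¬ IsSeparableState ρ ∧
    -- marginals and their KCBS noncontextuality
    marginalA ρ = Matrix.diagonal ![2 / 3, 1 / 6, 1 / 6] ∧
    marginalB ρ = Matrix.diagonal ![2 / 3, 1 / 6, 1 / 6] ∧
    expect (marginalA ρ) kcbsOp = 5 / 3 - 2 * √5 ∧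
    expect (marginalB ρ) kcbsOp = 5 / 3 - 2 * √5 ∧
    SatisfiesFiveCycle (marginalA ρ) ∧ SatisfiesFiveCycle (marginalB ρ) ∧
    IsNCHVLocal kcbsScenario.toScenario (kcbsScenario.localTable (marginalA ρ)) ∧
    IsNCHVLocal kcbsScenario.toScenario (kcbsScenario.localTable (marginalB ρ)) ∧
    IsNCHVLocal flagScenario.toScenario (flagScenario.localTable (marginalA ρ)) ∧
    -- postselection of Alice's flag
    probA ρ flagProj = 2 / 3 ∧
    conditionalB ρ flagProj = Matrix.diagonal ![19 / 24, 5 / 48, 5 / 48] ∧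
    expect (conditionalB ρ flagProj) kcbsOp = (35 - 33 * √5) / 12 ∧
    (35 - 33 * √5) / 12 < -3 ∧
    -- no global noncontextual model for Alice's flag together with Bob's KCBS measurements
    ¬ HasGNCHV flagScenario.toScenario kcbsScenario.toScenario Set.univ
      (jointTable flagScenario kcbsScenario ρ) := by
  subst hρ
  have hlocal : IsProjectiveLocal (flaggedWerner (1 / 2) (1 / 2)) :=
    isProjectiveLocal_flaggedWerner (by norm_num) (by norm_num) (by norm_num) (by norm_num)
  have hneg : (37 - 3 * √177) / 144 < 0 := by
    have := sqrt_177_gt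
    linarith
  -- The marginals have `κ = 1/6 + √5/10`, and `κ ≤ 2/5` means `√5 ≤ 7/3`; violation in the flagged
  -- branch means `√5 > 71/33`. The bounds `2.23` and `2.24` settle both.
  obtain ⟨h5, h5'⟩ := sqrt_five_bounds
  have hσ : (Matrix.diagonal ![2 / 3, 1 / 6, 1 / 6] : Matrix (Fin 3) (Fin 3) ℂ) =
      Matrix.diagonal ![((2 / 3 : ℝ) : ℂ), (1 / 6 : ℝ), (1 / 6 : ℝ)] := by norm_num
  have hτ : (Matrix.diagonal ![19 / 24, 5 / 48, 5 / 48] : Matrix (Fin 3) (Fin 3) ℂ) =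
      Matrix.diagonal ![((19 / 24 : ℝ) : ℂ), (5 / 48 : ℝ), (5 / 48 : ℝ)] := by norm_num
  have hexp : expect (Matrix.diagonal ![2 / 3, 1 / 6, 1 / 6]) kcbsOp = 5 / 3 - 2 * √5 := by
    rw [hσ, expect_kcbsOp, kcbsWeight_eq]
    ring
  have hcyc : SatisfiesFiveCycle (Matrix.diagonal ![2 / 3, 1 / 6, 1 / 6]) := by
    rw [hσ]
    apply satisfiesFiveCycle_diagonal <;> rw [kcbsWeight_eq] <;> linarith
  have hnc : IsNCHVLocal kcbsScenario.toScenario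
      (kcbsScenario.localTable (Matrix.diagonal ![2 / 3, 1 / 6, 1 / 6])) := by
    rw [hσ]
    apply isNCHVLocal_kcbs (by norm_num) <;> rw [kcbsWeight_eq] <;> linarith
  have hstate : IsState (Matrix.diagonal ![2 / 3, 1 / 6, 1 / 6] : Matrix (Fin 3) (Fin 3) ℂ) := by
    constructor
    · rw [hσ]
      refine Matrix.PosSemidef.diagonal fun i => ?_
      fin_cases i <;> exact Complex.zero_le_real.2 (by norm_num)
    · rw [Matrix.trace_diagonal, Fin.sum_univ_three]
      simp only [Matrix.cons_val]
      norm_num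
  rw [marginalA_flaggedWerner, marginalB_flaggedWerner, conditionalB_flaggedWerner]
  refine ⟨isState_flaggedWerner (by norm_num) (by norm_num) (by norm_num) (by norm_num), hlocal,
    hlocal.hasGLHV, isLeast_eigenvalue_partialTranspose, hneg,
    not_isSeparableState_of_hasEigenvector hneg hasEigenvector_partialTranspose, rfl, rfl, hexp,
    hexp, hcyc, hcyc, hnc, hnc, isNCHVLocal_flag hstate, probA_flaggedWerner, rfl, ?_, by linarith,
    not_hasGNCHV_flag_kcbs⟩
  rw [hτ, expect_kcbsOp, kcbsWeight_eq]
  ring
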